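/- Let $m\ge 1$, let $X\subset\mathbb R^d_{+}$ be convex and compact with $0\in X$, and let $\mathcal S=\{(f^1,b^1),\dots,(f^n,b^n)\}$ be a finite set of requests, where each $f^i:X\to\mathbb R_+$ is concave and each $b^i\in\mathbb R^{m\times d}$ has non-negative entries. Let $\rho\in\mathbb R^m$ have positive entries, let $r:\mathbb R^m\to\mathbb R$ be a regularizer, and let $w\in\mathbb R^m$ have positive entries; write $\|x\|_w^2=\sum_j w_jx_j^2$, $\|x\|_{w,*}^2=\sum_j x_j^2/w_j$, $r^*(-\mu)=\sup_{a\le\rho}\{r(a)+\mu^\top a\}$ and $D=\{\mu\in\mathbb R^m: r^*(-\mu)<+\infty\}$. Assumption 1: there are $\bar f,\bar b\ge 0$ with $f^i(x)\le\bar f$ and $\|b^ix\|_{w,*}\le\bar b$ for all $i$ and all $x\in X$. Assumption 2: $r$ is concave on $\{a\le\rho\}$; $|r(a_1)-r(a_2)|\le L\|a_1-a_2\|_{w,*}$ for all $a_1,a_2\le\rho$; for every $\mu\in D$ there is $a\in\arg\max_{a\le\rho}\{r(a)+\mu^\top a\}$ with $\|a\|_{w,*}\le\bar a$; and $\underline r\le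 r(b^ix)\le\bar r$ for all $i$ and all $x\in X$. For a horizon $T\ge1$ the requests $(f_t,b_t)$, $t=0,\dots,T-1$, are drawn independently from a distribution $\mathcal P$ on $\mathcal S$. Algorithm 1, with step size $\eta>0$ and initial point $\mu_0\in D$, starts from $B_0=T\rho$ and in period $t$ takes $\tilde x_t\in\arg\max_{x\in X}\{f_t(x)-\mu_t^\top b_tx\}$; $x_t=\tilde x_t$ if $b_t\tilde x_t\le B_t$ and $x_t=0$ otherwise; $a_t\in\arg\max_{a\le\rho}\{r(a)+\mu_t^\top a\}$ with $\|a_t\|_{w,*}\le\bar a$; $B_{t+1}=B_t-b_tx_t$; and $$\mu_{t+1}=\arg\min_{\mu\in D}\Big\{\langle -b_t\tilde x_t+a_t,\mu\rangle+\tfrac1{2\eta}\|\mu-\mu_t\|_w^2\Big\},$$ where ties in the choice of $\tilde x_t$ and $a_t$ are broken by any rule that uses only the requests received up to period $t$. Its regret is $$\mathrm{Regret}=\sup_{\mathcal P}\ \mathbb E_{\mathcal P}\Big[\sup_{y}\Big\{\sum_tf_t(y_t)+T\,r\Big(\tfrac1T\sum_tb_ty_t\Big)\Big\}-\sum_tf_t(x_t)-T\,r\Big(\tfrac1T\sum_tb_tx_t\Big)\Big],$$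 where the outer supremum is over all probability distributions $\mathcal P$ on $\mathcal S$ and the inner one over all $y_0,\dots,y_{T-1}\in X$ with $\sum_tb_ty_t\le T\rho$. Theorem. Under Assumptions 1 and 2, for every $T\ge1$ and $\eta>0$, $$\mathrm{Regret}\le C_1+C_2\,\eta T+\frac{C_3}{\eta},$$ where, with $\underline\rho=\min_j\rho_j$, $C_1=(\bar f+\bar r+L(\bar b+\bar a)-\underline r)/\underline\rho$, $C_2=(\bar b+\bar a)^2/2$ and $C_3=(L+C_1\|w\|_\infty^{1/2})^2+\|\mu_0\|_w^2$. Consequently, for fixed data and any $0<c\le c'$ there is a constant $K$ such that $\mathrm{Regret}\le K\sqrt T$ for all $T\ge1$ and all step sizes $\eta$ with $c\,T^{-1/2}\le\eta\le c'\,T^{-1/2}$. -/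

import Mathlib

open scoped Matrix

/-- The data of a regularized online allocation problem with `m` resources, actions in `ℝ^d` and
`n` possible requests `(f i, b i)`: a convex compact action set of non-negative vectors that contains
the void action, non-negative concave rewards, entrywise non-negative consumption matrices, positive
average resources `ρ`, and a regularizer `r` (only its values on `{a | a ≤ ρ}` and at the points
`b i *ᵥ x` matter). -/
structure AllocationProblem (m d n : ℕ) where
  X : Set (Fin d → ℝ)
  X_convex : Convex ℝ X
  X_compact : IsCompact X
  X_nonneg : ∀ x ∈ X, 0 ≤ x
  zero_mem : (0 : Fin d → ℝ) ∈ X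
  f : Fin n → (Fin d → ℝ) → ℝ
  f_nonneg : ∀ i, ∀ x ∈ X, 0 ≤ f i x
  f_concave : ∀ i, ConcaveOn ℝ X (f i)
  b : Fin n → Matrix (Fin m) (Fin d) ℝ
  b_nonneg : ∀ i j k, 0 ≤ b i j k
  ρ : Fin m → ℝ
  ρ_pos : ∀ j, 0 < ρ j
  r : (Fin m → ℝ) → ℝ

/-- The weighted Euclidean norm `‖x‖_w = (∑ j, w j * x j ^ 2) ^ (1/2)`. -/
noncomputable def wNorm {m : ℕ} (w x : Fin m → ℝ) : ℝ :=
  √(∑ j, w j * x j ^ 2)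

/-- The dual norm `‖x‖_{w,*} = (∑ j, x j ^ 2 / w j) ^ (1/2)`. -/
noncomputable def wDualNorm {m : ℕ} (w x : Fin m → ℝ) : ℝ :=
  √(∑ j, x j ^ 2 / w j)

namespace AllocationProblem

variable {m d n : ℕ}

/-- The conjugate of the regularizer at `-μ`, i.e. `r^*(-μ) = sup_{a ≤ ρ} (r a + μᵀ a)`, as an
extended real number. -/
noncomputable def conj (Q : AllocationProblem m d n) (μ : Fin m → ℝ) : EReal :=
  ⨆ a ∈ Set.Iic Q.ρ, ((Q.r a + μ ⬝ᵥ a : ℝ) : EReal)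

/-- The set of dual variables at which the conjugate of the regularizer is finite. -/
def dualDomain (Q : AllocationProblem m d n) : Set (Fin m → ℝ) :=
  {μ | Q.conj μ < ⊤}

/-- The total value `∑ t, f_t (x_t) + T * r ((1/T) ∑ t, b_t x_t)` of the actions `x` on the request
sequence `ω`. -/
noncomputable def value (Q : AllocationProblem m d n) {T : ℕ} (ω : Fin T → Fin n)
    (x : Fin T → Fin d → ℝ) : ℝ :=
  ∑ t, Q.f (ω t) (x t) + (T : ℝ) * Q.r ((1 / (T : ℝ)) • ∑ t, Q.b (ω t) *ᵥ x t)

/-- The value of the offline problem for the request sequence `ω`: the optimal value over all action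
sequences in `X` that respect `∑ t, b_t x_t ≤ T ρ`. -/
noncomputable def offlineValue (Q : AllocationProblem m d n) {T : ℕ} (ω : Fin T → Fin n) : ℝ :=
  sSup {v | ∃ x : Fin T → Fin d → ℝ, (∀ t, x t ∈ Q.X) ∧
    ∑ t, Q.b (ω t) *ᵥ x t ≤ (T : ℝ) • Q.ρ ∧ v = Q.value ω x}

/-- The expectation of `V` over `T` requests drawn independently from the distribution `p`. -/
noncomputable def expect {T : ℕ} (p : Fin n → ℝ) (V : (Fin T → Fin n) → ℝ) : ℝ :=
  ∑ ω, (∏ t, p (ω t)) * V ω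

/-- `OPT(p)`: the expected value of the offline problem. -/
noncomputable def OPT (Q : AllocationProblem m d n) (T : ℕ) (p : Fin n → ℝ) : ℝ :=
  expect p fun ω : Fin T → Fin n => Q.offlineValue ω

/-- The expected reward of the algorithm that takes action `x ω t` in period `t` when the requests
are `ω`. -/
noncomputable def expectedReward (Q : AllocationProblem m d n) {T : ℕ}
    (x : (Fin T → Fin n) → Fin T → Fin d → ℝ) (p : Fin n → ℝ) : ℝ :=
  expect p fun ω => Q.value ω (x ω)

/-- The worst-case regret over all distributions on the `n` requests, as an extended real number. -/
noncomputable def regret (Q : AllocationProblem m d n) {T : ℕ}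
    (x : (Fin T → Fin n) → Fin T → Fin d → ℝ) : EReal :=
  ⨆ p ∈ stdSimplex ℝ (Fin n), ((Q.OPT T p - Q.expectedReward x p : ℝ) : EReal)

/-- The bounds on the support of the distribution. -/
structure SupportBounds (Q : AllocationProblem m d n) (w : Fin m → ℝ) (fBar bBar : ℝ) : Prop where
  fBar_nonneg : 0 ≤ fBar
  bBar_nonneg : 0 ≤ bBar
  f_le : ∀ i, ∀ x ∈ Q.X, Q.f i x ≤ fBar
  b_le : ∀ i, ∀ x ∈ Q.X, wDualNorm w (Q.b i *ᵥ x) ≤ bBar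

/-- `a` maximizes `r a + μᵀ a` over `a ≤ ρ`. -/
def IsTarget (Q : AllocationProblem m d n) (μ a : Fin m → ℝ) : Prop :=
  a ≤ Q.ρ ∧ ∀ a' ≤ Q.ρ, Q.r a' + μ ⬝ᵥ a' ≤ Q.r a + μ ⬝ᵥ a

/-- The assumptions on the regularizer. -/
structure RegularizerBounds (Q : AllocationProblem m d n) (w : Fin m → ℝ)
    (L aBar rHi rLo : ℝ) : Prop where
  concave : ConcaveOn ℝ (Set.Iic Q.ρ) Q.r
  lipschitz : ∀ a₁ ≤ Q.ρ, ∀ a₂ ≤ Q.ρ, |Q.r a₁ - Q.r a₂| ≤ L * wDualNorm w (a₁ - a₂)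
  exists_target : ∀ μ ∈ Q.dualDomain, ∃ a, Q.IsTarget μ a ∧ wDualNorm w a ≤ aBar
  bounds : ∀ i, ∀ x ∈ Q.X, rLo ≤ Q.r (Q.b i *ᵥ x) ∧ Q.r (Q.b i *ᵥ x) ≤ rHi

/-- `Q.IsDualDescent w η aBar μ₀ xt x a μ B`: on every sequence `ω` of `T` requests, the
sequences `xt ω` (tentative actions), `x ω` (actions), `a ω` (target consumptions),
`μ ω` (dual variables) and `B ω` (remaining resources) are produced by dual subgradient descent with
weight `w`, step size `η` and initial dual variable `μ₀`. Ties in the two arg-max steps are broken by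
any rule that uses only the requests received so far; the target consumption is taken among the
maximizers of dual norm at most `aBar`. -/
structure IsDualDescent (Q : AllocationProblem m d n) {T : ℕ} (w : Fin m → ℝ) (η aBar : ℝ)
    (μ₀ : Fin m → ℝ)
    (xt x : (Fin T → Fin n) → Fin T → Fin d → ℝ)
    (a : (Fin T → Fin n) → Fin T → Fin m → ℝ)
    (μ B : (Fin T → Fin n) → Fin (T + 1) → Fin m → ℝ) : Prop where
  μ_zero : ∀ ω, μ ω 0 = μ₀
  B_zero : ∀ ω, B ω 0 = (T : ℝ) • Q.ρ
  xt_mem : ∀ ω t, xt ω t ∈ Q.X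
  xt_max : ∀ ω t, IsMaxOn
    (fun y => Q.f (ω t) y - μ ω t.castSucc ⬝ᵥ (Q.b (ω t) *ᵥ y)) Q.X (xt ω t)
  x_of_le : ∀ ω t, Q.b (ω t) *ᵥ xt ω t ≤ B ω t.castSucc → x ω t = xt ω t
  x_of_not_le : ∀ ω t, ¬ Q.b (ω t) *ᵥ xt ω t ≤ B ω t.castSucc → x ω t = 0
  a_target : ∀ ω t, Q.IsTarget (μ ω t.castSucc) (a ω t)
  a_norm : ∀ ω t, wDualNorm w (a ω t) ≤ aBar
  B_succ : ∀ ω t, B ω t.succ = B ω t.castSucc - Q.b (ω t) *ᵥ x ω t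
  μ_mem : ∀ ω t, μ ω t ∈ Q.dualDomain
  μ_succ : ∀ ω t, IsMinOn
    (fun ν => (-(Q.b (ω t) *ᵥ xt ω t) + a ω t) ⬝ᵥ ν
      + 1 / (2 * η) * wNorm w (ν - μ ω t.castSucc) ^ 2) Q.dualDomain (μ ω t.succ)
  nonanticipative : ∀ (t : Fin T) (ω ω' : Fin T → Fin n), (∀ s ≤ t, ω s = ω' s) →
    xt ω t = xt ω' t ∧ a ω t = a ω' t

end AllocationProblem

/-- The constant `C₁ = (fBar + rHi + L (bBar + aBar) - rLo) / min_j ρ_j`. -/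
noncomputable def constC₁ {m : ℕ} (ρ : Fin m → ℝ) (fBar bBar L aBar rHi rLo : ℝ) : ℝ :=
  (fBar + rHi + L * (bBar + aBar) - rLo) / ⨅ j, ρ j

/-- The constant `C₂ = (bBar + aBar)² / 2`. -/
noncomputable def constC₂ (bBar aBar : ℝ) : ℝ :=
  (bBar + aBar) ^ 2 / 2

/-- The constant `C₃ = (L + C₁ ‖w‖_∞^(1/2))² + ‖μ₀‖_w²`; the norm of `w : Fin m → ℝ` is the
supremum norm. -/
noncomputable def constC₃ {m : ℕ} (w μ₀ : Fin m → ℝ) (L C₁ : ℝ) : ℝ :=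
  (L + C₁ * √‖w‖) ^ 2 + wNorm w μ₀ ^ 2

/-!
Why the bound holds. By weak duality (`OPT_le_dual`) every dual variable `μ` in the domain satisfies
`OPT ≤ T (∑ i, p i * f_i^*(μ) + r^*(-μ))`. The algorithm attains the two suprema at `μ_t`, so its
period-`t` reward is the dual term `f_t^*(μ_t) + r^*(-μ_t)` minus `r a_t + μ_tᵀ (a_t - b_t x̃_t)`.
Let `τ` be the first period whose tentative action does not fit into the remaining resources.
Whether `t ≤ τ` is decided by the requests before `t`, on which alone `μ_t` depends (`state_congr`,
which uses uniqueness of the proximal minimizer). Hence averaging over the request of period `t`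
(`expect_apply_eq`) shows that each period `t ≤ τ` contributes a dual term of conditional
expectation at least `OPT / T`. The regret is therefore bounded by the expectation of a loss in
which the periods up to `τ` are charged their dual terms and the later ones are charged `V = OPT /
T`.

That loss is bounded on each request sequence separately (`IsDescentPath.loss_le`). Mirror descent
(`mirrorDescent_regret`) replaces `μ_t` by a fixed comparator `ν`, and `ν` is taken as a
supergradient of `r`, of norm at most `L`, at the average consumption (`exists_isTarget`, a
separation argument); then concavity of `r` absorbs all terms in `r`. If resource `j` is depleted
with `k ≥ 1` periods left, raising `ν` at coordinate `j` makes the excess consumption of `j` pay for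
the `k` periods without reward.

The additive constant `C₁` shrinks to zero when resources are measured in smaller units while
everything else in the bound stays the same, so it cannot pay for the action that is rejected in
period `τ`. With `E = fBar + L (bBar + aBar)`, that cost is covered by the AM-GM inequality between
two margins: the steepest-descent terms `η G² / 2`, `G = bBar + aBar`, that are not used up, and the
gap between `C₃ / η` and the distance term of the actual comparator. Their product is large enough
because `bBar √(w j) ≥ ρ j` when `j` is depleted, and `aBar ≥ ‖ρ‖_{w,*}` always
(`wDualNorm_rho_le`). For `k ≥ 1` the comparator is raised by `(E - E / k) / ρ j`, less than the
full amount `E / ρ j`; for `k = 0` it is not raised, and the last descent step is analysed with the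
gradient `a_τ` only.
-/

/-! ### The weighted norms -/

section Norms

variable {m : ℕ} {w : Fin m → ℝ}

lemma wNorm_nonneg (w x : Fin m → ℝ) : 0 ≤ wNorm w x := Real.sqrt_nonneg _

lemma wDualNorm_nonneg (w x : Fin m → ℝ) : 0 ≤ wDualNorm w x := Real.sqrt_nonneg _

lemma wNorm_eq_norm (hw : ∀ j, 0 < w j) (x : Fin m → ℝ) :
    wNorm w x = ‖WithLp.toLp 2 (fun j => √(w j) * x j)‖ := by
  simp only [wNorm, EuclideanSpace.norm_eq, Real.norm_eq_abs, sq_abs, mul_pow,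
    Real.sq_sqrt (hw _).le]

lemma wDualNorm_eq_norm (hw : ∀ j, 0 < w j) (x : Fin m → ℝ) :
    wDualNorm w x = ‖WithLp.toLp 2 (fun j => x j / √(w j))‖ := by
  simp only [wDualNorm, EuclideanSpace.norm_eq, Real.norm_eq_abs, sq_abs, div_pow,
    Real.sq_sqrt (hw _).le]

lemma wNorm_sq (hw : ∀ j, 0 < w j) (x : Fin m → ℝ) : wNorm w x ^ 2 = ∑ j, w j * x j ^ 2 :=
  Real.sq_sqrt (Finset.sum_nonneg fun j _ => mul_nonneg (hw j).le (sq_nonneg _))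

lemma wNorm_add_le (hw : ∀ j, 0 < w j) (x y : Fin m → ℝ) :
    wNorm w (x + y) ≤ wNorm w x + wNorm w y := by
  simp only [wNorm_eq_norm hw]
  refine le_trans (le_of_eq ?_) (norm_add_le _ _)
  congr 1
  ext j
  simp [mul_add]

lemma wDualNorm_add_le (hw : ∀ j, 0 < w j) (x y : Fin m → ℝ) :
    wDualNorm w (x + y) ≤ wDualNorm w x + wDualNorm w y := by
  simp only [wDualNorm_eq_norm hw]
  refine le_trans (le_of_eq ?_) (norm_add_le _ _)
  congr 1
  ext j
  simp [add_div]

lemma wNorm_smul (w : Fin m → ℝ) (c : ℝ) (x : Fin m → ℝ) :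
    wNorm w (c • x) = |c| * wNorm w x := by
  rw [wNorm, wNorm, ← Real.sqrt_sq_eq_abs, ← Real.sqrt_mul (sq_nonneg c), Finset.mul_sum]
  congr 1
  refine Finset.sum_congr rfl fun j _ => ?_
  simp only [Pi.smul_apply, smul_eq_mul]
  ring

lemma wDualNorm_smul (w : Fin m → ℝ) (c : ℝ) (x : Fin m → ℝ) :
    wDualNorm w (c • x) = |c| * wDualNorm w x := by
  rw [wDualNorm, wDualNorm, ← Real.sqrt_sq_eq_abs, ← Real.sqrt_mul (sq_nonneg c),
    Finset.mul_sum]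
  congr 1
  refine Finset.sum_congr rfl fun j _ => ?_
  simp only [Pi.smul_apply, smul_eq_mul]
  ring

lemma wNorm_neg (w x : Fin m → ℝ) : wNorm w (-x) = wNorm w x := by
  simpa using wNorm_smul w (-1) x

lemma wDualNorm_neg (w x : Fin m → ℝ) : wDualNorm w (-x) = wDualNorm w x := by
  simpa using wDualNorm_smul w (-1) x

lemma wDualNorm_zero (w : Fin m → ℝ) : wDualNorm w 0 = 0 := by
  simp [wDualNorm]

lemma wNorm_sub_sq_le (hw : ∀ j, 0 < w j) (x y : Fin m → ℝ) :
    wNorm w (x - y) ^ 2 ≤ 2 * (wNorm w x ^ 2 + wNorm w y ^ 2) := by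
  simp only [wNorm_sq hw, ← Finset.sum_add_distrib, Finset.mul_sum]
  refine Finset.sum_le_sum fun j _ => ?_
  simp only [Pi.sub_apply]
  nlinarith [mul_nonneg (hw j).le (sq_nonneg (x j + y j))]

lemma wDualNorm_sum_le (hw : ∀ j, 0 < w j) {ι : Type*} (s : Finset ι) (x : ι → Fin m → ℝ) :
    wDualNorm w (∑ i ∈ s, x i) ≤ ∑ i ∈ s, wDualNorm w (x i) :=
  Finset.le_sum_of_subadditive _ (wDualNorm_zero w).le (wDualNorm_add_le hw) s x

lemma dotProduct_le_wNorm_mul (hw : ∀ j, 0 < w j) (x y : Fin m → ℝ) :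
    x ⬝ᵥ y ≤ wNorm w x * wDualNorm w y := by
  rw [wNorm_eq_norm hw, wDualNorm_eq_norm hw]
  refine le_trans (le_of_eq ?_) (real_inner_le_norm _ _)
  simp only [PiLp.inner_apply, dotProduct, RCLike.inner_apply, conj_trivial]
  refine Finset.sum_congr rfl fun j _ => ?_
  have := (Real.sqrt_pos.2 (hw j)).ne'
  field_simp

lemma neg_wNorm_mul_le_dotProduct (hw : ∀ j, 0 < w j) (x y : Fin m → ℝ) :
    -(wNorm w x * wDualNorm w y) ≤ x ⬝ᵥ y := by
  have := dotProduct_le_wNorm_mul hw (-x) y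
  rw [wNorm_neg, neg_dotProduct] at this
  linarith

lemma wDualNorm_mono (hw : ∀ j, 0 < w j) {x y : Fin m → ℝ} (hx : 0 ≤ x) (hxy : x ≤ y) :
    wDualNorm w x ≤ wDualNorm w y := by
  refine Real.sqrt_le_sqrt (Finset.sum_le_sum fun j _ => ?_)
  have := hw j
  have := hx j
  have := hxy j
  simp only [Pi.zero_apply] at *
  gcongr

lemma le_sqrt_mul_wDualNorm (hw : ∀ j, 0 < w j) (x : Fin m → ℝ) (j : Fin m) :
    x j ≤ √(w j) * wDualNorm w x := by
  have h : x j ^ 2 / w j ≤ ∑ i, x i ^ 2 / w i :=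
    Finset.single_le_sum (f := fun i => x i ^ 2 / w i)
      (fun i _ => div_nonneg (sq_nonneg _) (hw i).le) (Finset.mem_univ j)
  rw [wDualNorm, ← Real.sqrt_mul (hw j).le]
  refine Real.le_sqrt_of_sq_le ?_
  rwa [div_le_iff₀ (hw j), mul_comm] at h

lemma wDualNorm_le_sum (hw : ∀ j, 0 < w j) {x : Fin m → ℝ} (hx : 0 ≤ x) :
    wDualNorm w x ≤ ∑ j, x j / √(w j) := by
  have h0 : ∀ j, 0 ≤ x j / √(w j) := fun j => div_nonneg (hx j) (Real.sqrt_nonneg _)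
  refine Real.sqrt_le_iff.2 ⟨Finset.sum_nonneg fun j _ => h0 j, ?_⟩
  refine le_trans (le_of_eq (Finset.sum_congr rfl fun j _ => ?_))
    (Finset.sum_sq_le_sq_sum_of_nonneg fun j _ => h0 j)
  rw [div_pow, Real.sq_sqrt (hw j).le]

lemma wNorm_single (w : Fin m → ℝ) (j : Fin m) (c : ℝ) (hc : 0 ≤ c) :
    wNorm w (Pi.single j c) = c * √(w j) := by
  rw [wNorm, Finset.sum_eq_single j]
  · rw [Pi.single_eq_same, mul_comm, Real.sqrt_mul (sq_nonneg c), Real.sqrt_sq hc]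
  · intro i _ hi
    simp [Pi.single_eq_of_ne hi]
  · simp

lemma continuous_wDualNorm (w : Fin m → ℝ) : Continuous (wDualNorm w) := by
  unfold wDualNorm
  fun_prop

/-- The norms `wNorm w` and `wDualNorm w` are dual to each other. -/
lemma wNorm_le_of_forall_dotProduct_le (hw : ∀ j, 0 < w j) {x : Fin m → ℝ} {L : ℝ}
    (hL : 0 ≤ L) (h : ∀ v, x ⬝ᵥ v ≤ L * wDualNorm w v) : wNorm w x ≤ L := by
  have hv := h fun j => w j * x j
  have h1 : (x ⬝ᵥ fun j => w j * x j) = wNorm w x ^ 2 := by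
    rw [wNorm_sq hw, dotProduct]
    exact Finset.sum_congr rfl fun j _ => by ring
  have h2 : wDualNorm w (fun j => w j * x j) = wNorm w x := by
    rw [wDualNorm, wNorm]
    congr 1
    refine Finset.sum_congr rfl fun j _ => ?_
    have := (hw j).ne'
    field_simp
  rw [h1, h2] at hv
  rcases (wNorm_nonneg w x).eq_or_lt with h0 | h0
  · rwa [← h0]
  · nlinarith

end Norms

namespace AllocationProblem
variable {m d n : ℕ}

/-! ### Geometry of the dual domain -/

section DualDomain

variable {Q : AllocationProblem m d n} {w : Fin m → ℝ} {L aBar rHi rLo : ℝ}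

lemma mem_dualDomain_iff {μ : Fin m → ℝ} :
    μ ∈ Q.dualDomain ↔ ∃ C : ℝ, ∀ a ≤ Q.ρ, Q.r a + μ ⬝ᵥ a ≤ C := by
  refine ⟨fun h => ?_, fun ⟨C, hC⟩ => ?_⟩
  · obtain ⟨C, hC, -⟩ := EReal.lt_iff_exists_real_btwn.1 h
    refine ⟨C, fun a ha => EReal.coe_le_coe_iff.1 (le_trans ?_ hC.le)⟩
    exact le_iSup₂ (f := fun a (_ : a ∈ Set.Iic Q.ρ) => ((Q.r a + μ ⬝ᵥ a : ℝ) : EReal)) a ha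
  · refine lt_of_le_of_lt (iSup₂_le fun a ha => ?_) (EReal.coe_lt_top C)
    exact EReal.coe_le_coe_iff.2 (hC a ha)

lemma IsTarget.mem_dualDomain {μ a : Fin m → ℝ} (h : Q.IsTarget μ a) : μ ∈ Q.dualDomain :=
  mem_dualDomain_iff.2 ⟨_, h.2⟩

lemma convex_dualDomain (Q : AllocationProblem m d n) : Convex ℝ Q.dualDomain := by
  intro μ hμ ν hν s t hs ht hst
  obtain ⟨C, hC⟩ := mem_dualDomain_iff.1 hμ
  obtain ⟨C', hC'⟩ := mem_dualDomain_iff.1 hν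
  refine mem_dualDomain_iff.2 ⟨s * C + t * C', fun a ha => ?_⟩
  rw [add_dotProduct, smul_dotProduct, smul_dotProduct, smul_eq_mul, smul_eq_mul]
  calc Q.r a + (s * μ ⬝ᵥ a + t * ν ⬝ᵥ a)
      = s * (Q.r a + μ ⬝ᵥ a) + t * (Q.r a + ν ⬝ᵥ a) := by linear_combination (-Q.r a) * hst
    _ ≤ s * C + t * C' := by
      gcongr
      · exact hC a ha
      · exact hC' a ha

/-- The dual domain is upward closed, because the maximization is over `a ≤ ρ`. -/
lemma dualDomain_add_mem {μ ν : Fin m → ℝ} (hμ : μ ∈ Q.dualDomain) (hν : 0 ≤ ν) :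
    μ + ν ∈ Q.dualDomain := by
  obtain ⟨C, hC⟩ := mem_dualDomain_iff.1 hμ
  refine mem_dualDomain_iff.2 ⟨C + ν ⬝ᵥ Q.ρ, fun a ha => ?_⟩
  have h1 := dotProduct_le_dotProduct_of_nonneg_left ha hν
  have h2 := hC a ha
  rw [add_dotProduct]
  linarith

namespace RegularizerBounds

lemma lipschitz_nonneg (hR : Q.RegularizerBounds w L aBar rHi rLo) (hw : ∀ j, 0 < w j)
    (hm : 1 ≤ m) : 0 ≤ L := by
  have h1 := hR.lipschitz Q.ρ le_rfl (Q.ρ - 1) (by simp)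
  rw [sub_sub_cancel] at h1
  have h2 : (1 : ℝ) ≤ √(w ⟨0, hm⟩) * wDualNorm w 1 := le_sqrt_mul_wDualNorm hw 1 ⟨0, hm⟩
  have h3 : 0 < wDualNorm w 1 := by
    refine (wDualNorm_nonneg w 1).lt_of_ne fun h => ?_
    rw [← h] at h2
    linarith
  exact nonneg_of_mul_nonneg_left ((abs_nonneg _).trans h1) h3

lemma r_le_add (hR : Q.RegularizerBounds w L aBar rHi rLo) {a a' : Fin m → ℝ}
    (ha : a ≤ Q.ρ) (ha' : a' ≤ Q.ρ) : Q.r a ≤ Q.r a' + L * wDualNorm w (a - a') := by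
  have := (abs_le.1 (hR.lipschitz a ha a' ha')).2
  linarith

/-- Dual variables in the domain have a negative part of norm at most `L`. -/
lemma neg_dotProduct_le (hR : Q.RegularizerBounds w L aBar rHi rLo)
    {μ c : Fin m → ℝ} (hμ : μ ∈ Q.dualDomain) (hc : 0 ≤ c) :
    -(μ ⬝ᵥ c) ≤ L * wDualNorm w c := by
  obtain ⟨C, hC⟩ := mem_dualDomain_iff.1 hμ
  by_contra! h
  set ε := -(μ ⬝ᵥ c) - L * wDualNorm w c with hε
  have hε0 : 0 < ε := by linarith
  -- Moving from `ρ` in the direction `-c` gains `ε` per unit of length.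
  have key : ∀ s : ℝ, 0 ≤ s → s * ε ≤ C - Q.r Q.ρ - μ ⬝ᵥ Q.ρ := by
    intro s hs
    have hle : Q.ρ - s • c ≤ Q.ρ := sub_le_self _ (smul_nonneg hs hc)
    have h1 := hR.r_le_add le_rfl hle
    have h2 := hC _ hle
    rw [sub_sub_cancel, wDualNorm_smul, abs_of_nonneg hs] at h1
    rw [dotProduct_sub, dotProduct_smul, smul_eq_mul] at h2
    rw [hε]
    linarith
  have h3 := key ((|C - Q.r Q.ρ - μ ⬝ᵥ Q.ρ| + 1) / ε) (by positivity)
  rw [div_mul_cancel₀ _ hε0.ne'] at h3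
  linarith [le_abs_self (C - Q.r Q.ρ - μ ⬝ᵥ Q.ρ)]

/-- The bound `aBar` on the target consumptions dominates `‖ρ‖_{w,*}`: when all dual variables
are large, the only target consumption is `ρ`. -/
lemma wDualNorm_rho_le (hR : Q.RegularizerBounds w L aBar rHi rLo) (hw : ∀ j, 0 < w j)
    (hL : 0 ≤ L) : wDualNorm w Q.ρ ≤ aBar := by
  set μ : Fin m → ℝ := fun j => L / √(w j) + 1 with hμ
  have key : ∀ a ≤ Q.ρ, Q.r a + μ ⬝ᵥ a + ∑ j, (Q.ρ - a) j ≤ Q.r Q.ρ + μ ⬝ᵥ Q.ρ := by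
    intro a ha
    have h1 := hR.r_le_add ha le_rfl
    have h2 : wDualNorm w (a - Q.ρ) ≤ ∑ j, (Q.ρ - a) j / √(w j) := by
      rw [← neg_sub, wDualNorm_neg]
      exact wDualNorm_le_sum hw (sub_nonneg.2 ha)
    have h3 : μ ⬝ᵥ (Q.ρ - a) = L * ∑ j, (Q.ρ - a) j / √(w j) + ∑ j, (Q.ρ - a) j := by
      rw [dotProduct, Finset.mul_sum, ← Finset.sum_add_distrib]
      exact Finset.sum_congr rfl fun j _ => by rw [hμ]; ring
    rw [dotProduct_sub] at h3
    nlinarith [mul_le_mul_of_nonneg_left h2 hL]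
  have hmem : μ ∈ Q.dualDomain := mem_dualDomain_iff.2 ⟨Q.r Q.ρ + μ ⬝ᵥ Q.ρ, fun a ha => by
    have := key a ha
    have : 0 ≤ ∑ j, (Q.ρ - a) j := Finset.sum_nonneg fun j _ => sub_nonneg.2 (ha j)
    linarith⟩
  obtain ⟨a, ha, hn⟩ := hR.exists_target μ hmem
  have h1 := key a ha.1
  have h2 := ha.2 _ le_rfl
  have h0 : ∀ j ∈ Finset.univ, 0 ≤ (Q.ρ - a) j := fun j _ => sub_nonneg.2 (ha.1 j)
  have h3 : ∑ j, (Q.ρ - a) j = 0 := le_antisymm (by linarith) (Finset.sum_nonneg h0)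
  have h4 : a = Q.ρ := by
    funext j
    have := (Finset.sum_eq_zero_iff_of_nonneg h0).1 h3 j (Finset.mem_univ j)
    simp only [Pi.sub_apply] at this
    linarith
  rwa [← h4]

/-- Every `p ≤ ρ` is the target consumption of a dual variable of norm at most `L`. Equivalently,
`r` has a supergradient of norm at most `L` at `p`, also at boundary points of `{a | a ≤ ρ}`. It is
found by separating the hypograph of `r` from the open cone above the graph of
`x ↦ r p + L ‖x - p‖_{w,*}`. -/
lemma exists_isTarget (hR : Q.RegularizerBounds w L aBar rHi rLo) (hw : ∀ j, 0 < w j)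
    (hL : 0 ≤ L) {p : Fin m → ℝ} (hp : p ≤ Q.ρ) :
    ∃ μ, Q.IsTarget μ p ∧ wNorm w μ ≤ L := by
  set A : Set ((Fin m → ℝ) × ℝ) := {z | Q.r p + L * wDualNorm w (z.1 - p) < z.2} with hA
  have hAo : IsOpen A := by
    have := continuous_wDualNorm w
    exact isOpen_lt (by fun_prop) (by fun_prop)
  have hAc : Convex ℝ A := by
    have hcv : ConvexOn ℝ Set.univ fun x : Fin m → ℝ => Q.r p + L * wDualNorm w (x - p) := by
      refine ⟨convex_univ, fun x _ y _ s t hs ht hst => ?_⟩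
      have h1 : s • x + t • y - p = s • (x - p) + t • (y - p) := by
        rw [smul_sub, smul_sub]
        have : p = s • p + t • p := by rw [← add_smul, hst, one_smul]
        nth_rewrite 1 [this]
        abel
      have h2 := wDualNorm_add_le hw (s • (x - p)) (t • (y - p))
      rw [wDualNorm_smul, wDualNorm_smul, abs_of_nonneg hs, abs_of_nonneg ht] at h2
      simp only [h1, smul_eq_mul]
      have h3 := mul_le_mul_of_nonneg_left h2 hL
      have h4 : Q.r p = s * Q.r p + t * Q.r p := by rw [← add_mul, hst, one_mul]
      linarith
    simpa [hA] using hcv.convex_strict_epigraph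
  have hdisj : Disjoint A {z : (Fin m → ℝ) × ℝ | z.1 ∈ Set.Iic Q.ρ ∧ z.2 ≤ Q.r z.1} := by
    rw [Set.disjoint_left]
    rintro z hz ⟨hz1, hz2⟩
    have := hR.r_le_add hz1 hp
    simp only [hA, Set.mem_ofPred_eq] at hz
    linarith
  obtain ⟨F, u, hFA, hFB⟩ := geometric_hahn_banach_open hAc hAo hR.concave.convex_hypograph hdisj
  set ℓ : (Fin m → ℝ) →ₗ[ℝ] ℝ := F.toLinearMap ∘ₗ LinearMap.inl ℝ _ _ with hℓ
  set s : ℝ := F (0, 1) with hs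
  have hF : ∀ x t, F (x, t) = ℓ x + s * t := by
    intro x t
    have : ((x, t) : (Fin m → ℝ) × ℝ) = (x, 0) + t • (0, 1) := by simp
    rw [this, map_add, map_smul, smul_eq_mul, mul_comm]
    rfl
  have hcone : ∀ v, ∀ ε > 0, ℓ (p + v) + s * (Q.r p + L * wDualNorm w v + ε) < u := by
    intro v ε hε
    rw [← hF]
    refine hFA _ ?_
    simp only [hA, Set.mem_ofPred_eq, add_sub_cancel_left]
    linarith
  have hyp : ∀ a ≤ Q.ρ, u ≤ ℓ a + s * Q.r a := fun a ha => by
    rw [← hF]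
    exact hFB _ ⟨ha, le_rfl⟩
  have hs0 : s < 0 := by
    have h1 := hcone 0 1 one_pos
    have h2 := hyp p hp
    rw [wDualNorm_zero, add_zero] at h1
    linarith
  have hu : ∀ v, ℓ (p + v) + s * (Q.r p + L * wDualNorm w v) ≤ u := by
    intro v
    refine le_of_forall_pos_le_add fun ε hε => ?_
    have h1 := hcone v (ε / (-s)) (div_pos hε (by linarith))
    have h2 : s * (ε / (-s)) = -ε := by
      rw [div_neg, mul_neg, mul_div_cancel₀ _ hs0.ne]
    linarith
  have hpu : u = ℓ p + s * Q.r p := le_antisymm (hyp p hp) (by simpa [wDualNorm_zero] using hu 0)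
  have hdot : ∀ v, (fun j => ℓ (Pi.single j 1) / s) ⬝ᵥ v = ℓ v / s := by
    intro v
    rw [LinearMap.pi_apply_eq_sum_univ ℓ v, dotProduct, Finset.sum_div]
    refine Finset.sum_congr rfl fun j _ => ?_
    rw [smul_eq_mul, div_mul_eq_mul_div, mul_comm]
    congr 3
    ext i
    simp [Pi.single_apply, eq_comm]
  refine ⟨fun j => ℓ (Pi.single j 1) / s, ⟨hp, fun a ha => ?_⟩,
    wNorm_le_of_forall_dotProduct_le hw hL fun v => ?_⟩
  · have h1 := hyp a ha
    rw [hpu] at h1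
    have h2 := div_le_div_of_nonpos_of_le hs0.le h1
    rw [add_div, add_div, mul_div_cancel_left₀ _ hs0.ne, mul_div_cancel_left₀ _ hs0.ne] at h2
    rw [hdot, hdot]
    linarith
  · have h1 := hu (-v)
    rw [hpu, wDualNorm_neg, map_add, map_neg] at h1
    rw [hdot, div_le_iff_of_neg hs0]
    linarith

end RegularizerBounds

end DualDomain

/-! ### Online mirror descent -/

section MirrorDescent

variable {w : Fin m → ℝ}

/-- A minimizer of a linear function plus a quadratic proximity term minimizes with a quadratic
margin. -/
lemma three_point (hw : ∀ j, 0 < w j) {D : Set (Fin m → ℝ)} (hD : Convex ℝ D) {η : ℝ}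
    (hη : 0 < η) {g μ ν' ν : Fin m → ℝ} (hν' : ν' ∈ D) (hν : ν ∈ D)
    (hmin : IsMinOn (fun x => g ⬝ᵥ x + 1 / (2 * η) * wNorm w (x - μ) ^ 2) D ν') :
    g ⬝ᵥ ν' + 1 / (2 * η) * wNorm w (ν' - μ) ^ 2 + 1 / (2 * η) * wNorm w (ν - ν') ^ 2 ≤
      g ⬝ᵥ ν + 1 / (2 * η) * wNorm w (ν - μ) ^ 2 := by
  have hη' : 0 < 1 / (2 * η) := by positivity
  set κ := 1 / (2 * η)
  set q := κ * wNorm w (ν - ν') ^ 2 with hq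
  set Δ := g ⬝ᵥ ν + κ * wNorm w (ν - μ) ^ 2 - (g ⬝ᵥ ν' + κ * wNorm w (ν' - μ) ^ 2) with hΔ
  have hq0 : 0 ≤ q := by positivity
  -- Compare `ν'` with the points `(1 - θ) ν' + θ ν` and let `θ → 0`.
  have key : ∀ θ : ℝ, 0 < θ → θ < 1 → (1 - θ) * q ≤ Δ := by
    intro θ h0 h1
    have hmem : (1 - θ) • ν' + θ • ν ∈ D := hD hν' hν (by linarith) h0.le (by ring)
    have h2 := hmin hmem
    simp only [Set.mem_ofPred_eq] at h2
    have h3 : wNorm w ((1 - θ) • ν' + θ • ν - μ) ^ 2 = (1 - θ) * wNorm w (ν' - μ) ^ 2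
        + θ * wNorm w (ν - μ) ^ 2 - θ * (1 - θ) * wNorm w (ν - ν') ^ 2 := by
      simp only [wNorm_sq hw, Finset.mul_sum, ← Finset.sum_add_distrib, ← Finset.sum_sub_distrib]
      refine Finset.sum_congr rfl fun j _ => ?_
      simp only [Pi.sub_apply, Pi.add_apply, Pi.smul_apply, smul_eq_mul]
      ring
    rw [h3, dotProduct_add, dotProduct_smul, dotProduct_smul, smul_eq_mul, smul_eq_mul] at h2
    have h4 : θ * ((1 - θ) * q) ≤ θ * Δ := by
      rw [hq, hΔ]
      linarith
    exact le_of_mul_le_mul_left h4 h0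
  have : q ≤ Δ := by
    by_contra! h
    rcases hq0.eq_or_lt with h0 | h0
    · have := key (1 / 2) (by norm_num) (by norm_num)
      rw [← h0] at h this
      linarith
    · rcases le_or_gt Δ 0 with hΔ0 | hΔ0
      · have := key (1 / 2) (by norm_num) (by norm_num)
        linarith
      · have h5 := key ((q - Δ) / (2 * q)) (by apply div_pos <;> linarith)
          (by rw [div_lt_one (by linarith)]; linarith)
        have h6 : (1 - (q - Δ) / (2 * q)) * q = (q + Δ) / 2 := by
          field_simp
          ring
        linarith
  linarith

lemma isMinOn_prox_unique (hw : ∀ j, 0 < w j) {D : Set (Fin m → ℝ)} (hD : Convex ℝ D) {η : ℝ}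
    (hη : 0 < η) {g μ ν ν' : Fin m → ℝ} (hν : ν ∈ D) (hν' : ν' ∈ D)
    (hmin : IsMinOn (fun x => g ⬝ᵥ x + 1 / (2 * η) * wNorm w (x - μ) ^ 2) D ν)
    (hmin' : IsMinOn (fun x => g ⬝ᵥ x + 1 / (2 * η) * wNorm w (x - μ) ^ 2) D ν') : ν = ν' := by
  have h1 := three_point hw hD hη hν hν' hmin
  have h2 := hmin' hν
  simp only [Set.mem_ofPred_eq] at h2
  have hη' : 0 < 1 / (2 * η) := by positivity
  have h3 : wNorm w (ν' - ν) ^ 2 ≤ 0 := by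
    by_contra! h
    have := mul_pos hη' h
    linarith
  rw [wNorm_sq hw] at h3
  have h0 : ∀ j ∈ Finset.univ, 0 ≤ w j * (ν' - ν) j ^ 2 :=
    fun j _ => mul_nonneg (hw j).le (sq_nonneg _)
  funext j
  have h4 := (Finset.sum_eq_zero_iff_of_nonneg h0).1
    (le_antisymm h3 (Finset.sum_nonneg h0)) j (Finset.mem_univ j)
  have h5 : (ν' - ν) j = 0 := by simpa [(hw j).ne'] using h4
  simp only [Pi.sub_apply] at h5
  linarith

/-- Completing the square. -/
lemma dotProduct_sub_prox_le (hw : ∀ j, 0 < w j) {η : ℝ} (hη : 0 < η) {G : ℝ}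
    {g : Fin m → ℝ} (hg : wDualNorm w g ≤ G) (μ ν : Fin m → ℝ) :
    g ⬝ᵥ (μ - ν) - 1 / (2 * η) * wNorm w (ν - μ) ^ 2 ≤ η * G ^ 2 / 2 := by
  have h1 := dotProduct_le_wNorm_mul hw (μ - ν) g
  rw [dotProduct_comm, ← neg_sub ν μ, wNorm_neg, neg_sub] at h1
  have h2 := mul_le_mul_of_nonneg_left hg (wNorm_nonneg w (ν - μ))
  have h3 : wNorm w (ν - μ) * G ≤ η * G ^ 2 / 2 + 1 / (2 * η) * wNorm w (ν - μ) ^ 2 := by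
    have h4 : η * G ^ 2 / 2 + 1 / (2 * η) * wNorm w (ν - μ) ^ 2 - wNorm w (ν - μ) * G
        = (η * G - wNorm w (ν - μ)) ^ 2 / (2 * η) := by
      field_simp
      ring
    have : 0 ≤ (η * G - wNorm w (ν - μ)) ^ 2 / (2 * η) := by positivity
    linarith
  linarith

/-- The regret bound of online mirror descent over the first `N` steps. -/
lemma mirrorDescent_regret (hw : ∀ j, 0 < w j) {D : Set (Fin m → ℝ)} (hD : Convex ℝ D) {η : ℝ}
    (hη : 0 < η) {G : ℝ} {g μ : ℕ → Fin m → ℝ} {N : ℕ} (hμ : ∀ t ≤ N, μ t ∈ D)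
    (hg : ∀ t < N, wDualNorm w (g t) ≤ G)
    (hmin : ∀ t < N, IsMinOn
      (fun x => g t ⬝ᵥ x + 1 / (2 * η) * wNorm w (x - μ t) ^ 2) D (μ (t + 1)))
    {ν : Fin m → ℝ} (hν : ν ∈ D) :
    ∑ t ∈ Finset.range N, g t ⬝ᵥ (μ t - ν) + 1 / (2 * η) * wNorm w (ν - μ N) ^ 2 ≤
      1 / (2 * η) * wNorm w (ν - μ 0) ^ 2 + N * (η * G ^ 2 / 2) := by
  induction N with
  | zero => simp
  | succ N ih =>
    have h1 := ih (fun t ht => hμ t (by omega)) (fun t ht => hg t (by omega))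
      (fun t ht => hmin t (by omega))
    have h2 := three_point hw hD hη (hμ (N + 1) le_rfl) hν (hmin N (by omega))
    have h3 := dotProduct_sub_prox_le hw hη (hg N (by omega)) (μ N) (μ (N + 1))
    rw [Finset.sum_range_succ]
    rw [dotProduct_sub] at h3 ⊢
    push_cast
    linarith

end MirrorDescent

/-! ### The loss along a single request sequence -/

section Path

/-- A single run of dual subgradient descent over the periods `t < T`, on the request sequence `i`.
The sequences are indexed by `ℕ` and their values from `T` on (for `μ`, after `T`) are irrelevant;
the remaining resources are written as `T ρ` minus the past consumption. -/
structure IsDescentPath (Q : AllocationProblem m d n) (T : ℕ) (w : Fin m → ℝ) (η aBar : ℝ)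
    (i : ℕ → Fin n) (xt x : ℕ → Fin d → ℝ) (a μ : ℕ → Fin m → ℝ) : Prop where
  xt_mem : ∀ t < T, xt t ∈ Q.X
  x_of_le : ∀ t < T, Q.b (i t) *ᵥ xt t ≤
    (T : ℝ) • Q.ρ - ∑ s ∈ Finset.range t, Q.b (i s) *ᵥ x s → x t = xt t
  x_of_not_le : ∀ t < T, ¬ Q.b (i t) *ᵥ xt t ≤
    (T : ℝ) • Q.ρ - ∑ s ∈ Finset.range t, Q.b (i s) *ᵥ x s → x t = 0
  a_target : ∀ t < T, Q.IsTarget (μ t) (a t)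
  a_norm : ∀ t < T, wDualNorm w (a t) ≤ aBar
  μ_mem : ∀ t ≤ T, μ t ∈ Q.dualDomain
  μ_succ : ∀ t < T, IsMinOn
    (fun ν => (-(Q.b (i t) *ᵥ xt t) + a t) ⬝ᵥ ν + 1 / (2 * η) * wNorm w (ν - μ t) ^ 2)
    Q.dualDomain (μ (t + 1))

lemma mulVec_nonneg (Q : AllocationProblem m d n) (i : Fin n) {x : Fin d → ℝ} (hx : x ∈ Q.X) :
    0 ≤ Q.b i *ᵥ x := fun j => by
  rw [Matrix.mulVec, dotProduct]
  exact Finset.sum_nonneg fun k _ => mul_nonneg (Q.b_nonneg i j k) (Q.X_nonneg x hx k)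

lemma rho_nonneg (Q : AllocationProblem m d n) : 0 ≤ Q.ρ := fun j => (Q.ρ_pos j).le

/-- The dual objective of a period: the maximal reward net of the dual price of the consumption,
attained at the tentative action `xt`, plus the conjugate of the regularizer, attained at the target
consumption `a`. -/
def dualTerm (Q : AllocationProblem m d n) (i : Fin n) (xt : Fin d → ℝ) (a μ : Fin m → ℝ) : ℝ :=
  Q.f i xt - μ ⬝ᵥ (Q.b i *ᵥ xt) + (Q.r a + μ ⬝ᵥ a)

lemma IsTarget.sum_le {Q : AllocationProblem m d n} {ν p : Fin m → ℝ} (hν : Q.IsTarget ν p)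
    {N : ℕ} {a : ℕ → Fin m → ℝ} (ha : ∀ t < N, a t ≤ Q.ρ) :
    ∑ t ∈ Finset.range N, (Q.r (a t) + ν ⬝ᵥ a t) ≤ N * (Q.r p + ν ⬝ᵥ p) := by
  refine (Finset.sum_le_card_nsmul _ _ _ fun t ht => hν.2 _ (ha t (Finset.mem_range.1 ht))).trans ?_
  rw [Finset.card_range, nsmul_eq_mul]

lemma mul_le_div_add_div {η β Z : ℝ} (hη : 0 < η) : β * Z ≤ η * β ^ 2 / 2 + Z ^ 2 / η := by
  have h : η * β ^ 2 / 2 + Z ^ 2 / η - β * Z = ((η * β - Z) ^ 2 + Z ^ 2) / (2 * η) := by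
    field_simp
    ring
  have : 0 ≤ ((η * β - Z) ^ 2 + Z ^ 2) / (2 * η) := by positivity
  linarith

lemma sq_add_mul_le {L Z M s : ℝ} (hL : 0 ≤ L) (hs : 0 ≤ s) (hsZ : s ≤ Z) (hM : L + Z ≤ M) :
    (L + (Z - s)) ^ 2 + Z * s ≤ M ^ 2 := by
  have h := pow_le_pow_left₀ (add_nonneg hL (hs.trans hsZ)) hM 2
  nlinarith [mul_nonneg hL hs, mul_nonneg hs (sub_nonneg.2 hsZ)]

lemma average_le_rho {Q : AllocationProblem m d n} {T : ℕ} (hT : 1 ≤ T) {v : Fin m → ℝ}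
    (hv : v ≤ (T : ℝ) • Q.ρ) :
    (1 / (T : ℝ)) • v ≤ Q.ρ := by
  have hT' : (0 : ℝ) < T := by exact_mod_cast hT
  have := smul_le_smul_of_nonneg_left hv (by positivity : 0 ≤ 1 / (T : ℝ))
  rwa [smul_smul, one_div_mul_cancel hT'.ne', one_smul] at this

lemma prox_sq_le {w : Fin m → ℝ} {η : ℝ} (hw : ∀ j, 0 < w j) (hη : 0 < η) {ν μ₀ : Fin m → ℝ} {R : ℝ}
    (hν : wNorm w ν ≤ R) :
    1 / (2 * η) * wNorm w (ν - μ₀) ^ 2 ≤ (R ^ 2 + wNorm w μ₀ ^ 2) / η := by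
  have h1 := wNorm_sub_sq_le hw ν μ₀
  have h2 := pow_le_pow_left₀ (wNorm_nonneg w ν) hν 2
  rw [one_div_mul_eq_div, div_le_div_iff₀ (by positivity) hη]
  nlinarith

namespace IsDescentPath

variable {Q : AllocationProblem m d n} {T : ℕ} {w : Fin m → ℝ} {η fBar bBar L aBar rHi rLo : ℝ}
  {i : ℕ → Fin n} {xt x : ℕ → Fin d → ℝ} {a μ : ℕ → Fin m → ℝ}

lemma x_mem (h : Q.IsDescentPath T w η aBar i xt x a μ) {t : ℕ} (ht : t < T) : x t ∈ Q.X := by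
  by_cases hle : Q.b (i t) *ᵥ xt t ≤ (T : ℝ) • Q.ρ - ∑ s ∈ Finset.range t, Q.b (i s) *ᵥ x s
  · rw [h.x_of_le t ht hle]
    exact h.xt_mem t ht
  · rw [h.x_of_not_le t ht hle]
    exact Q.zero_mem

lemma sum_le (h : Q.IsDescentPath T w η aBar i xt x a μ) {t : ℕ} (ht : t ≤ T) :
    ∑ s ∈ Finset.range t, Q.b (i s) *ᵥ x s ≤ (T : ℝ) • Q.ρ := by
  induction t with
  | zero => simpa using smul_nonneg (Nat.cast_nonneg T) Q.rho_nonneg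
  | succ t ih =>
    rw [Finset.sum_range_succ]
    by_cases hle : Q.b (i t) *ᵥ xt t ≤ (T : ℝ) • Q.ρ - ∑ s ∈ Finset.range t, Q.b (i s) *ᵥ x s
    · rw [h.x_of_le t ht hle, add_comm]
      exact le_sub_iff_add_le.1 hle
    · rw [h.x_of_not_le t ht hle, Matrix.mulVec_zero, add_zero]
      exact ih (by omega)

lemma average_le (h : Q.IsDescentPath T w η aBar i xt x a μ) (hT : 1 ≤ T) {t : ℕ} (ht : t ≤ T) :
    (1 / (T : ℝ)) • ∑ s ∈ Finset.range t, Q.b (i s) *ᵥ x s ≤ Q.ρ :=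
  average_le_rho hT (h.sum_le ht)

lemma gradient_norm_le (h : Q.IsDescentPath T w η aBar i xt x a μ) (hw : ∀ j, 0 < w j)
    (hS : Q.SupportBounds w fBar bBar) {t : ℕ} (ht : t < T) :
    wDualNorm w (-(Q.b (i t) *ᵥ xt t) + a t) ≤ bBar + aBar := by
  have h1 := wDualNorm_add_le hw (-(Q.b (i t) *ᵥ xt t)) (a t)
  rw [wDualNorm_neg] at h1
  linarith [hS.b_le (i t) _ (h.xt_mem t ht), h.a_norm t ht]

/-- The mirror descent bound, in the form that trades the dual variables `μ t` in the dual
objective for a fixed comparator `ν`. -/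
lemma sum_dualTerm_le (h : Q.IsDescentPath T w η aBar i xt x a μ) (hw : ∀ j, 0 < w j) (hη : 0 < η)
    (hS : Q.SupportBounds w fBar bBar) {ν : Fin m → ℝ} (hν : ν ∈ Q.dualDomain) {N : ℕ}
    (hN : N ≤ T) :
    ∑ t ∈ Finset.range N, Q.dualTerm (i t) (xt t) (a t) (μ t)
        + 1 / (2 * η) * wNorm w (ν - μ N) ^ 2 ≤
      ∑ t ∈ Finset.range N, Q.f (i t) (xt t)
        + ∑ t ∈ Finset.range N, (Q.r (a t) + ν ⬝ᵥ a t)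
        - ν ⬝ᵥ ∑ t ∈ Finset.range N, Q.b (i t) *ᵥ xt t
        + 1 / (2 * η) * wNorm w (ν - μ 0) ^ 2 + N * (η * (bBar + aBar) ^ 2 / 2) := by
  have h1 := mirrorDescent_regret hw Q.convex_dualDomain hη
    (g := fun t => -(Q.b (i t) *ᵥ xt t) + a t) (G := bBar + aBar)
    (fun t ht => h.μ_mem t (ht.trans hN)) (fun t ht => h.gradient_norm_le hw hS (ht.trans_le hN))
    (fun t ht => h.μ_succ t (ht.trans_le hN)) hν
  have h2 : ∑ t ∈ Finset.range N, Q.dualTerm (i t) (xt t) (a t) (μ t) =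
      ∑ t ∈ Finset.range N, Q.f (i t) (xt t)
        + ∑ t ∈ Finset.range N, (Q.r (a t) + ν ⬝ᵥ a t)
        - ν ⬝ᵥ ∑ t ∈ Finset.range N, Q.b (i t) *ᵥ xt t
        + ∑ t ∈ Finset.range N, (-(Q.b (i t) *ᵥ xt t) + a t) ⬝ᵥ (μ t - ν) := by
    rw [dotProduct_sum, ← Finset.sum_add_distrib, ← Finset.sum_sub_distrib,
      ← Finset.sum_add_distrib]
    refine Finset.sum_congr rfl fun t _ => ?_
    rw [dualTerm, add_dotProduct, neg_dotProduct, dotProduct_sub, dotProduct_sub,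
      dotProduct_comm _ (μ t), dotProduct_comm _ ν, dotProduct_comm (a t), dotProduct_comm (a t)]
    ring
  linarith

/-- The loss when the resources are never depleted. The comparator is the supergradient of `r` at
the average consumption. -/
lemma loss_le_of_forall_eq (h : Q.IsDescentPath T w η aBar i xt x a μ) (hw : ∀ j, 0 < w j)
    (hη : 0 < η) (hT : 1 ≤ T) (hS : Q.SupportBounds w fBar bBar)
    (hR : Q.RegularizerBounds w L aBar rHi rLo) (hL : 0 ≤ L) (hx : ∀ t < T, x t = xt t) :
    ∑ t ∈ Finset.range T, Q.dualTerm (i t) (xt t) (a t) (μ t)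
        - (∑ t ∈ Finset.range T, Q.f (i t) (x t)
          + T * Q.r ((1 / (T : ℝ)) • ∑ t ∈ Finset.range T, Q.b (i t) *ᵥ x t)) ≤
      η * T * (bBar + aBar) ^ 2 / 2 + (L ^ 2 + wNorm w (μ 0) ^ 2) / η := by
  have hT' : (0 : ℝ) < T := by exact_mod_cast hT
  obtain ⟨ν, hν, hνL⟩ := hR.exists_isTarget hw hL (h.average_le hT le_rfl)
  set p := (1 / (T : ℝ)) • ∑ t ∈ Finset.range T, Q.b (i t) *ᵥ x t with hp
  have h1 := h.sum_dualTerm_le hw hη hS hν.mem_dualDomain le_rfl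
  have h2 := hν.sum_le (N := T) fun t ht => (h.a_target t ht).1
  have h3 := prox_sq_le hw hη (μ₀ := μ 0) hνL
  have h4 : ∑ t ∈ Finset.range T, Q.b (i t) *ᵥ xt t = (T : ℝ) • p := by
    rw [hp, smul_smul, mul_one_div_cancel hT'.ne', one_smul]
    exact Finset.sum_congr rfl fun t ht => by rw [hx t (Finset.mem_range.1 ht)]
  have h5 : ∑ t ∈ Finset.range T, Q.f (i t) (x t) = ∑ t ∈ Finset.range T, Q.f (i t) (xt t) :=
    Finset.sum_congr rfl fun t ht => by rw [hx t (Finset.mem_range.1 ht)]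
  have h6 : 0 ≤ 1 / (2 * η) * wNorm w (ν - μ T) ^ 2 := by positivity
  rw [h4, dotProduct_smul, smul_eq_mul] at h1
  linarith

/-- When some resource `j` is depleted, a single action can consume more than `ρ j` of it. -/
lemma exists_rho_lt (h : Q.IsDescentPath T w η aBar i xt x a μ) (hw : ∀ j, 0 < w j)
    (hS : Q.SupportBounds w fBar bBar) {τ : ℕ} (hτ : τ < T) (hx : ∀ t < τ, x t = xt t)
    (hfail : ¬ Q.b (i τ) *ᵥ xt τ ≤ (T : ℝ) • Q.ρ - ∑ s ∈ Finset.range τ, Q.b (i s) *ᵥ x s) :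
    ∃ j, T * Q.ρ j < (∑ t ∈ Finset.range (τ + 1), Q.b (i t) *ᵥ xt t) j ∧
      Q.ρ j < √(w j) * bBar := by
  rw [Pi.le_def, not_forall] at hfail
  obtain ⟨j, hj⟩ := hfail
  have h1 : T * Q.ρ j < (∑ t ∈ Finset.range (τ + 1), Q.b (i t) *ᵥ xt t) j := by
    rw [Finset.sum_range_succ, Finset.sum_congr rfl fun t ht => by
      rw [← hx t (Finset.mem_range.1 ht)]]
    simp only [Pi.sub_apply, Pi.smul_apply, smul_eq_mul, Pi.add_apply, not_le] at hj ⊢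
    linarith
  refine ⟨j, h1, ?_⟩
  have h2 : (∑ t ∈ Finset.range (τ + 1), Q.b (i t) *ᵥ xt t) j ≤ T * (√(w j) * bBar) := by
    rw [Finset.sum_apply]
    calc ∑ t ∈ Finset.range (τ + 1), (Q.b (i t) *ᵥ xt t) j
        ≤ (Finset.range (τ + 1)).card • (√(w j) * bBar) := by
          refine Finset.sum_le_card_nsmul _ _ _ fun t ht => ?_
          have ht' : t < T := by have := Finset.mem_range.1 ht; omega
          exact (le_sqrt_mul_wDualNorm hw _ j).trans (mul_le_mul_of_nonneg_left
            (hS.b_le _ _ (h.xt_mem t ht')) (Real.sqrt_nonneg _))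
      _ ≤ T * (√(w j) * bBar) := by
          rw [Finset.card_range, nsmul_eq_mul]
          have := hS.bBar_nonneg
          gcongr
          exact_mod_cast hτ
  exact lt_of_mul_lt_mul_left (h1.trans_le h2) (Nat.cast_nonneg T)

/-- The loss when the resources are depleted in the last period. The consumption of that
period does not count, so its mirror descent step is analysed with the gradient `a` in place of
`a - b x`; the difference in the quadratic term pays for the lost reward. -/
lemma loss_le_of_depleted_last {τ : ℕ} (h : Q.IsDescentPath (τ + 1) w η aBar i xt x a μ)
    (hw : ∀ j, 0 < w j) (hη : 0 < η) (hS : Q.SupportBounds w fBar bBar)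
    (hR : Q.RegularizerBounds w L aBar rHi rLo) (hL : 0 ≤ L) (ha0 : 0 ≤ aBar) {M : ℝ}
    (hM : ∀ j, L + (fBar + L * (bBar + aBar)) / Q.ρ j * √(w j) ≤ M)
    (hx : ∀ t < τ, x t = xt t)
    (hfail : ¬ Q.b (i τ) *ᵥ xt τ ≤
      ((τ + 1 : ℕ) : ℝ) • Q.ρ - ∑ s ∈ Finset.range τ, Q.b (i s) *ᵥ x s) :
    ∑ t ∈ Finset.range (τ + 1), Q.dualTerm (i t) (xt t) (a t) (μ t)
        - (∑ t ∈ Finset.range (τ + 1), Q.f (i t) (x t) + (τ + 1 : ℕ) *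
          Q.r ((1 / ((τ + 1 : ℕ) : ℝ)) • ∑ t ∈ Finset.range (τ + 1), Q.b (i t) *ᵥ x t)) ≤
      η * (τ + 1 : ℕ) * (bBar + aBar) ^ 2 / 2 + (M ^ 2 + wNorm w (μ 0) ^ 2) / η := by
  obtain ⟨j, -, hj⟩ := h.exists_rho_lt hw hS (Nat.lt_succ_self τ) hx hfail
  have hxτ := h.x_of_not_le τ (Nat.lt_succ_self τ) hfail
  have hT' : (0 : ℝ) < (τ + 1 : ℕ) := by positivity
  obtain ⟨ν, hν, hνL⟩ := hR.exists_isTarget hw hL (h.average_le (by omega) le_rfl)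
  set p := (1 / ((τ + 1 : ℕ) : ℝ)) • ∑ t ∈ Finset.range (τ + 1), Q.b (i t) *ᵥ x t with hp
  have h1 := h.sum_dualTerm_le hw hη hS hν.mem_dualDomain (Nat.le_succ τ)
  have h2 := hν.sum_le (N := τ + 1) fun t ht => (h.a_target t ht).1
  have h3 := prox_sq_le hw hη (μ₀ := μ 0) hνL
  have h4 : ∑ t ∈ Finset.range τ, Q.b (i t) *ᵥ xt t = ((τ + 1 : ℕ) : ℝ) • p := by
    rw [hp, smul_smul, mul_one_div_cancel hT'.ne', one_smul, Finset.sum_range_succ, hxτ,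
      Matrix.mulVec_zero, add_zero]
    exact Finset.sum_congr rfl fun t ht => by rw [hx t (Finset.mem_range.1 ht)]
  have h5 : ∑ t ∈ Finset.range τ, Q.f (i t) (x t) = ∑ t ∈ Finset.range τ, Q.f (i t) (xt t) :=
    Finset.sum_congr rfl fun t ht => by rw [hx t (Finset.mem_range.1 ht)]
  have h6 : 0 ≤ Q.f (i τ) (x τ) := Q.f_nonneg _ _ (h.x_mem (Nat.lt_succ_self τ))
  have h7 := dotProduct_sub_prox_le hw hη (h.a_norm τ (Nat.lt_succ_self τ)) (μ τ) ν
  have hτm := h.xt_mem τ (Nat.lt_succ_self τ)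
  have h8 : -(μ τ ⬝ᵥ (Q.b (i τ) *ᵥ xt τ)) ≤ L * bBar :=
    (hR.neg_dotProduct_le (h.μ_mem τ (Nat.le_succ τ)) (Q.mulVec_nonneg _ hτm)).trans
      (mul_le_mul_of_nonneg_left (hS.b_le _ _ hτm) hL)
  have h9 := hS.f_le (i τ) _ hτm
  rw [h4, dotProduct_smul, smul_eq_mul] at h1
  rw [Finset.sum_range_succ] at h2
  rw [Finset.sum_range_succ, Finset.sum_range_succ _ τ, h5, dualTerm]
  rw [dotProduct_sub, dotProduct_comm (a τ), dotProduct_comm (a τ)] at h7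
  have hρ := Q.ρ_pos j
  have hf := hS.fBar_nonneg
  have hb := hS.bBar_nonneg
  set E := fBar + L * (bBar + aBar) with hE
  have hE0 : 0 ≤ E := by positivity
  set Z := E / Q.ρ j * √(w j) with hZ
  have hZ0 : 0 ≤ Z := by positivity
  have h10 : E ≤ bBar * Z := by
    have : bBar * Z = E * (√(w j) * bBar / Q.ρ j) := by rw [hZ]; ring
    rw [this]
    exact le_mul_of_one_le_right hE0 ((one_le_div hρ).2 hj.le)
  have h11 : E ≤ η * bBar ^ 2 / 2 + Z ^ 2 / η := h10.trans (mul_le_div_add_div hη)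
  have h12 : (L ^ 2 + wNorm w (μ 0) ^ 2) / η + Z ^ 2 / η ≤ (M ^ 2 + wNorm w (μ 0) ^ 2) / η := by
    rw [← add_div, div_le_div_iff_of_pos_right hη]
    have := sq_add_mul_le hL hZ0 le_rfl (hM j)
    rw [sub_self, add_zero] at this
    linarith
  have h13 : η * aBar ^ 2 / 2 + η * bBar ^ 2 / 2 ≤ η * (bBar + aBar) ^ 2 / 2 := by
    linarith [mul_nonneg hη.le (mul_nonneg hb ha0)]
  have h14 : fBar + L * bBar ≤ E := by
    rw [hE, mul_add]
    linarith [mul_nonneg hL ha0]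
  push_cast at h1 h2 ⊢
  linarith

/-- The loss when the resources are depleted in period `τ`, with `k ≥ 1` periods left. In
each of these periods the offline solution gains at most `V`. The comparator is the supergradient of
`r` at the consumption before `τ`, raised by `(E - E / k) / ρ j` at the depleted resource `j`, where
`E = fBar + L (bBar + aBar)`. The raise pays for the remaining periods up to the total amount `E`;
that amount and the loss of period `τ` are covered by the unused descent steps and by the margin
between the norm of the comparator and `M`. -/
lemma loss_le_of_depleted (h : Q.IsDescentPath T w η aBar i xt x a μ)
    (hw : ∀ j, 0 < w j) (hη : 0 < η) (hS : Q.SupportBounds w fBar bBar)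
    (hR : Q.RegularizerBounds w L aBar rHi rLo) (hL : 0 ≤ L) {M V : ℝ}
    (hM : ∀ j, L + (fBar + L * (bBar + aBar)) / Q.ρ j * √(w j) ≤ M)
    (hV : V ≤ fBar + Q.r 0 + L * aBar) {τ : ℕ} (hτ : τ + 1 < T) (hx : ∀ t < τ, x t = xt t)
    (hfail : ¬ Q.b (i τ) *ᵥ xt τ ≤
      (T : ℝ) • Q.ρ - ∑ s ∈ Finset.range τ, Q.b (i s) *ᵥ x s) :
    (T - (τ + 1 : ℕ)) * V + ∑ t ∈ Finset.range (τ + 1), Q.dualTerm (i t) (xt t) (a t) (μ t)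
        - (∑ t ∈ Finset.range T, Q.f (i t) (x t) + T *
          Q.r ((1 / (T : ℝ)) • ∑ t ∈ Finset.range T, Q.b (i t) *ᵥ x t)) ≤
      η * T * (bBar + aBar) ^ 2 / 2 + (M ^ 2 + wNorm w (μ 0) ^ 2) / η := by
  have hτ' : τ < T := by omega
  obtain ⟨j, hover, hj⟩ := h.exists_rho_lt hw hS hτ' hx hfail
  have hxτ := h.x_of_not_le τ hτ' hfail
  have hT' : (0 : ℝ) < T := by exact_mod_cast (by omega : 0 < T)
  have haρ := hR.wDualNorm_rho_le hw hL
  have ha0 : 0 ≤ aBar := (wDualNorm_nonneg _ _).trans haρ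
  have hρ := Q.ρ_pos j
  have hf := hS.fBar_nonneg
  have hb := hS.bBar_nonneg
  set k : ℝ := T - (τ + 1 : ℕ) with hk
  have hk1 : 1 ≤ k := by
    have : ((τ + 1 + 1 : ℕ) : ℝ) ≤ T := by exact_mod_cast hτ
    rw [hk]
    push_cast at this ⊢
    linarith
  have hk0 : 0 < k := by linarith
  set E := fBar + L * (bBar + aBar) with hE
  have hE0 : 0 ≤ E := by positivity
  set Z := E / Q.ρ j * √(w j) with hZ
  have hZ0 : 0 ≤ Z := by positivity
  set δ := (E - E / k) / Q.ρ j with hδ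
  have hδ0 : 0 ≤ δ := div_nonneg (sub_nonneg.2 (div_le_self hE0 hk1)) hρ.le
  obtain ⟨ν, hν, hνL⟩ := hR.exists_isTarget hw hL (h.average_le (by omega) hτ'.le)
  set p := (1 / (T : ℝ)) • ∑ t ∈ Finset.range τ, Q.b (i t) *ᵥ x t with hp
  have hple : p ≤ Q.ρ := hν.1
  have hmem : ν + Pi.single j δ ∈ Q.dualDomain :=
    dualDomain_add_mem hν.mem_dualDomain (Pi.single_nonneg.2 hδ0)
  have h1 := h.sum_dualTerm_le hw hη hS hmem (N := τ + 1) hτ'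
  have h2 := hν.sum_le (N := τ + 1) (a := a) fun t ht => (h.a_target t (by omega)).1
  have hnorm : wNorm w (ν + Pi.single j δ) ≤ L + (Z - Z / k) := by
    have h3 := wNorm_add_le hw ν (Pi.single j δ)
    rw [wNorm_single w j δ hδ0] at h3
    have : δ * √(w j) = Z - Z / k := by rw [hδ, hZ]; ring
    linarith
  have h3 := prox_sq_le hw hη (μ₀ := μ 0) hnorm
  have hfsum : ∑ t ∈ Finset.range τ, Q.f (i t) (xt t) ≤ ∑ t ∈ Finset.range T, Q.f (i t) (x t) := by
    rw [Finset.sum_congr rfl fun t ht => by rw [← hx t (Finset.mem_range.1 ht)]]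
    exact Finset.sum_le_sum_of_subset_of_nonneg (Finset.range_subset_range.2 hτ'.le)
      fun t ht _ => Q.f_nonneg _ _ (h.x_mem (Finset.mem_range.1 ht))
  have hτm := h.xt_mem τ hτ'
  have h9 := hS.f_le (i τ) _ hτm
  have hcτ : -(ν ⬝ᵥ (Q.b (i τ) *ᵥ xt τ)) ≤ L * bBar := by
    have h4 := neg_wNorm_mul_le_dotProduct hw ν (Q.b (i τ) *ᵥ xt τ)
    have h5 := mul_le_mul hνL (hS.b_le (i τ) _ hτm) (wDualNorm_nonneg _ _) hL
    linarith
  -- The consumption after `τ` moves the average consumption away from `p` by little.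
  have hlast : T * Q.r p - k * (L * bBar) ≤
      T * Q.r ((1 / (T : ℝ)) • ∑ t ∈ Finset.range T, Q.b (i t) *ᵥ x t) := by
    set q := (1 / (T : ℝ)) • ∑ t ∈ Finset.range T, Q.b (i t) *ᵥ x t with hq
    have h4 := hR.r_le_add hple (h.average_le (by omega) le_rfl)
    have h5 : p - q = -((1 / (T : ℝ)) • ∑ t ∈ Finset.Ico (τ + 1) T, Q.b (i t) *ᵥ x t) := by
      have h6 := Finset.sum_range_add_sum_Ico (fun t => Q.b (i t) *ᵥ x t) hτ.le
      rw [Finset.sum_range_succ, hxτ, Matrix.mulVec_zero, add_zero] at h6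
      rw [hp, hq, ← h6, smul_add]
      abel
    have h6 : wDualNorm w (p - q) ≤ 1 / T * (k * bBar) := by
      rw [h5, wDualNorm_neg, wDualNorm_smul, abs_of_nonneg (by positivity)]
      refine mul_le_mul_of_nonneg_left ?_ (by positivity)
      refine (wDualNorm_sum_le hw _ _).trans ?_
      refine (Finset.sum_le_card_nsmul _ _ bBar fun t ht => ?_).trans (le_of_eq ?_)
      · exact hS.b_le _ _ (h.x_mem (Finset.mem_Ico.1 ht).2)
      · rw [Nat.card_Ico, nsmul_eq_mul, Nat.cast_sub hτ.le]
    have h7 := mul_le_mul_of_nonneg_left (h4.trans (add_le_add_right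
      (mul_le_mul_of_nonneg_left h6 hL) _)) hT'.le
    have h8 : (T : ℝ) * (Q.r q + L * (1 / T * (k * bBar))) = T * Q.r q + k * (L * bBar) := by
      field_simp
    linarith
  have h0ρ := hν.2 0 Q.rho_nonneg
  rw [dotProduct_zero, add_zero] at h0ρ
  -- The raise at resource `j` gains because this resource is depleted.
  have hgain : ∑ t ∈ Finset.range (τ + 1), (Q.r (a t) + (ν + Pi.single j δ) ⬝ᵥ a t)
      - (ν + Pi.single j δ) ⬝ᵥ ∑ t ∈ Finset.range (τ + 1), Q.b (i t) *ᵥ xt t ≤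
      ∑ t ∈ Finset.range (τ + 1), (Q.r (a t) + ν ⬝ᵥ a t)
      - ν ⬝ᵥ ∑ t ∈ Finset.range (τ + 1), Q.b (i t) *ᵥ xt t - k * (E - E / k) := by
    have h4 : ∑ t ∈ Finset.range (τ + 1), (Q.r (a t) + (ν + Pi.single j δ) ⬝ᵥ a t) =
        ∑ t ∈ Finset.range (τ + 1), (Q.r (a t) + ν ⬝ᵥ a t)
        + δ * ∑ t ∈ Finset.range (τ + 1), a t j := by
      rw [Finset.mul_sum, ← Finset.sum_add_distrib]
      refine Finset.sum_congr rfl fun t _ => ?_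
      rw [add_dotProduct, single_dotProduct]
      ring
    have h5 : ∑ t ∈ Finset.range (τ + 1), a t j ≤ (τ + 1 : ℕ) * Q.ρ j := by
      refine (Finset.sum_le_card_nsmul _ _ (Q.ρ j) fun t ht => ?_).trans (le_of_eq ?_)
      · have := Finset.mem_range.1 ht
        exact (h.a_target t (by omega)).1 j
      · rw [Finset.card_range, nsmul_eq_mul]
    have h6 : δ * (∑ t ∈ Finset.range (τ + 1), a t j
        - (∑ t ∈ Finset.range (τ + 1), Q.b (i t) *ᵥ xt t) j) ≤ δ * (-(k * Q.ρ j)) := by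
      refine mul_le_mul_of_nonneg_left ?_ hδ0
      rw [hk]
      linarith
    have h7 : δ * (-(k * Q.ρ j)) = -(k * (E - E / k)) := by
      rw [hδ]
      field_simp
    rw [h4, add_dotProduct, single_dotProduct]
    linarith
  have hsum : ν ⬝ᵥ ∑ t ∈ Finset.range (τ + 1), Q.b (i t) *ᵥ xt t =
      T * (ν ⬝ᵥ p) + ν ⬝ᵥ (Q.b (i τ) *ᵥ xt τ) := by
    rw [Finset.sum_range_succ, dotProduct_add, ← smul_eq_mul, ← dotProduct_smul, hp, smul_smul,
      mul_one_div_cancel hT'.ne', one_smul]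
    congr 2
    exact Finset.sum_congr rfl fun t ht => by rw [hx t (Finset.mem_range.1 ht)]
  have hkE : k * (E - E / k) = k * E - E := by
    field_simp
  have hbr : k * (V + L * bBar - (Q.r p + ν ⬝ᵥ p)) ≤ k * E := by
    refine mul_le_mul_of_nonneg_left ?_ hk0.le
    rw [hE]
    linarith
  -- The slack: `2 E ≤ G Z` with `G = bBar + aBar`, as both `bBar` and `aBar` exceed `ρ j / √(w j)`.
  have hGZ : 2 * E ≤ (bBar + aBar) * Z := by
    have h4 : Q.ρ j ≤ √(w j) * aBar := (le_sqrt_mul_wDualNorm hw Q.ρ j).trans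
      (mul_le_mul_of_nonneg_left haρ (Real.sqrt_nonneg _))
    have h5 : (bBar + aBar) * Z = E * ((√(w j) * bBar + √(w j) * aBar) / Q.ρ j) := by
      rw [hZ]
      ring
    rw [h5, mul_comm 2]
    refine mul_le_mul_of_nonneg_left ?_ hE0
    rw [le_div_iff₀ hρ]
    linarith
  have hslack := hGZ.trans (mul_le_div_add_div (mul_pos hk0 hη))
  have hmargin : ((L + (Z - Z / k)) ^ 2 + wNorm w (μ 0) ^ 2) / η + Z ^ 2 / (k * η) ≤
      (M ^ 2 + wNorm w (μ 0) ^ 2) / η := by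
    rw [← div_div, ← add_div, div_le_div_iff_of_pos_right hη]
    have h4 := sq_add_mul_le hL (by positivity : 0 ≤ Z / k) (div_le_self hZ0 hk1) (hM j)
    have h5 : Z ^ 2 / k = Z * (Z / k) := by ring
    linarith
  have h14 : fBar + L * bBar ≤ E := by
    rw [hE, mul_add]
    linarith [mul_nonneg hL ha0]
  have h6 : 0 ≤ 1 / (2 * η) * wNorm w (ν + Pi.single j δ - μ (τ + 1)) ^ 2 := by positivity
  rw [Finset.sum_range_succ (fun t => Q.f (i t) (xt t))] at h1
  have hkτ : ((τ + 1 : ℕ) : ℝ) = T - k := by rw [hk]; ring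
  rw [hkτ] at h1 h2
  rw [hsum] at hgain
  rw [hkE] at hgain
  have h15 : (T - k) * (η * (bBar + aBar) ^ 2 / 2) + k * η * (bBar + aBar) ^ 2 / 2 =
      η * T * (bBar + aBar) ^ 2 / 2 := by ring
  have h16 : k * V + k * (L * bBar) - (k * Q.r p + k * (ν ⬝ᵥ p)) ≤ k * E := by linarith
  have h17 : ∑ t ∈ Finset.range (τ + 1), (Q.r (a t) + ν ⬝ᵥ a t) ≤
      T * Q.r p + T * (ν ⬝ᵥ p) - (k * Q.r p + k * (ν ⬝ᵥ p)) := by linarith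
  clear_value k E Z δ p
  linarith only [h1, h3, h6, h9, h14, h15, h16, h17, hfsum, hcτ, hlast, hgain, hslack, hmargin]

end IsDescentPath

end Path

open scoped Classical in
/-- The loss along a run. Each period up to and including the first one in which the
tentative action does not fit into the remaining resources is charged its dual term, each later
period is charged `V`. -/
lemma IsDescentPath.loss_le {Q : AllocationProblem m d n} {T : ℕ} {w : Fin m → ℝ}
    {η fBar bBar L aBar rHi rLo : ℝ} {i : ℕ → Fin n} {xt x : ℕ → Fin d → ℝ}
    {a μ : ℕ → Fin m → ℝ} (h : Q.IsDescentPath T w η aBar i xt x a μ) (hT : 1 ≤ T)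
    (hw : ∀ j, 0 < w j) (hη : 0 < η) (hS : Q.SupportBounds w fBar bBar)
    (hR : Q.RegularizerBounds w L aBar rHi rLo) (hL : 0 ≤ L) {M V : ℝ} (hLM : L ≤ M)
    (hM : ∀ j, L + (fBar + L * (bBar + aBar)) / Q.ρ j * √(w j) ≤ M)
    (hV : V ≤ fBar + Q.r 0 + L * aBar) :
    ∑ t ∈ Finset.range T, (if ∀ s < t, Q.b (i s) *ᵥ xt s ≤
          (T : ℝ) • Q.ρ - ∑ s' ∈ Finset.range s, Q.b (i s') *ᵥ x s'
        then Q.dualTerm (i t) (xt t) (a t) (μ t) else V)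
        - (∑ t ∈ Finset.range T, Q.f (i t) (x t)
          + T * Q.r ((1 / (T : ℝ)) • ∑ t ∈ Finset.range T, Q.b (i t) *ᵥ x t)) ≤
      η * T * (bBar + aBar) ^ 2 / 2 + (M ^ 2 + wNorm w (μ 0) ^ 2) / η := by
  have ha0 : 0 ≤ aBar := (wDualNorm_nonneg _ _).trans (hR.wDualNorm_rho_le hw hL)
  set fits : ℕ → Prop := fun s => Q.b (i s) *ᵥ xt s ≤
    (T : ℝ) • Q.ρ - ∑ s' ∈ Finset.range s, Q.b (i s') *ᵥ x s' with hfits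
  by_cases hall : ∀ t < T, fits t
  · have h1 := h.loss_le_of_forall_eq hw hη hT hS hR hL fun t ht => h.x_of_le t ht (hall t ht)
    rw [Finset.sum_congr rfl fun t ht => if_pos fun s hs =>
      hall s (hs.trans (Finset.mem_range.1 ht))]
    have h2 : (L ^ 2 + wNorm w (μ 0) ^ 2) / η ≤ (M ^ 2 + wNorm w (μ 0) ^ 2) / η := by
      gcongr
    linarith
  · push Not at hall
    obtain ⟨τ, hτ, hfail, hbefore⟩ : ∃ τ < T, ¬ fits τ ∧ ∀ t < τ, fits t := by
      obtain ⟨hτ, hfail⟩ := Nat.find_spec hall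
      refine ⟨Nat.find hall, hτ, hfail, fun t ht => ?_⟩
      by_contra hc
      exact Nat.find_min hall ht ⟨ht.trans hτ, hc⟩
    have hx : ∀ t < τ, x t = xt t := fun t ht => h.x_of_le t (ht.trans hτ) (hbefore t ht)
    have hsum : ∑ t ∈ Finset.range T, (if ∀ s < t, fits s
          then Q.dualTerm (i t) (xt t) (a t) (μ t) else V) =
        (T - (τ + 1 : ℕ)) * V
          + ∑ t ∈ Finset.range (τ + 1), Q.dualTerm (i t) (xt t) (a t) (μ t) := by
      have hτ' : τ + 1 ≤ T := hτ
      rw [← Finset.sum_range_add_sum_Ico _ hτ', add_comm]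
      congr 1
      · rw [Finset.sum_congr rfl fun t ht => if_neg fun hc =>
          hfail (hc τ (by have := (Finset.mem_Ico.1 ht).1; omega)),
          Finset.sum_const, Nat.card_Ico, nsmul_eq_mul, Nat.cast_sub hτ']
      · exact Finset.sum_congr rfl fun t ht => if_pos fun s hs =>
          hbefore s (by have := Finset.mem_range.1 ht; omega)
    rw [hsum]
    rcases Nat.lt_or_ge (τ + 1) T with hlt | hge
    · exact h.loss_le_of_depleted hw hη hS hR hL hM hV hlt hx hfail
    · obtain rfl : T = τ + 1 := by omega
      have := h.loss_le_of_depleted_last hw hη hS hR hL ha0 hM hx hfail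
      rwa [sub_self, zero_mul, zero_add]

/-! ### From the algorithm on all request sequences to single runs -/

namespace IsDualDescent

variable {Q : AllocationProblem m d n} {T : ℕ} {w : Fin m → ℝ} {η aBar : ℝ} {μ₀ : Fin m → ℝ}
  {xt x : (Fin T → Fin n) → Fin T → Fin d → ℝ} {a : (Fin T → Fin n) → Fin T → Fin m → ℝ}
  {μ B : (Fin T → Fin n) → Fin (T + 1) → Fin m → ℝ}

/-- The dual variables and the remaining resources at the start of a period are functions of the
earlier requests. -/
lemma state_congr (h : Q.IsDualDescent w η aBar μ₀ xt x a μ B) (hw : ∀ j, 0 < w j) (hη : 0 < η)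
    {ω ω' : Fin T → Fin n} (k : Fin (T + 1)) (hω : ∀ s : Fin T, s.castSucc < k → ω s = ω' s) :
    μ ω k = μ ω' k ∧ B ω k = B ω' k := by
  induction k using Fin.induction with
  | zero => exact ⟨by rw [h.μ_zero, h.μ_zero], by rw [h.B_zero, h.B_zero]⟩
  | succ t ih =>
    obtain ⟨ihμ, ihB⟩ := ih fun s hs => hω s (hs.trans t.castSucc_lt_succ)
    have hle : ∀ s ≤ t, ω s = ω' s := fun s hs => hω s (Fin.castSucc_lt_succ_iff.2 hs)
    obtain ⟨hxt, ha⟩ := h.nonanticipative t ω ω' hle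
    have ht := hle t le_rfl
    have hx : x ω t = x ω' t := by
      by_cases hc : Q.b (ω t) *ᵥ xt ω t ≤ B ω t.castSucc
      · rw [h.x_of_le ω t hc, hxt]
        rw [ht, hxt, ihB] at hc
        rw [h.x_of_le ω' t hc]
      · rw [h.x_of_not_le ω t hc]
        rw [ht, hxt, ihB] at hc
        rw [h.x_of_not_le ω' t hc]
    refine ⟨?_, by rw [h.B_succ, h.B_succ, ihB, ht, hx]⟩
    have h1 := h.μ_succ ω t
    rw [ht, hxt, ha, ihμ] at h1
    exact isMinOn_prox_unique hw Q.convex_dualDomain hη (h.μ_mem _ _) (h.μ_mem _ _) h1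
      (h.μ_succ ω' t)

lemma B_eq (h : Q.IsDualDescent w η aBar μ₀ xt x a μ B) (ω : Fin T → Fin n) {ι : ℕ → Fin T}
    (hι : ∀ t < T, (ι t : ℕ) = t) {t : ℕ} (ht : t < T) :
    B ω (ι t).castSucc = (T : ℝ) • Q.ρ - ∑ s ∈ Finset.range t, Q.b (ω (ι s)) *ᵥ x ω (ι s) := by
  induction t with
  | zero =>
    have : (ι 0).castSucc = 0 := Fin.ext (by simpa using hι 0 ht)
    rw [this, h.B_zero, Finset.sum_range_zero, sub_zero]
  | succ t ih =>
    have : (ι (t + 1)).castSucc = (ι t).succ :=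
      Fin.ext (by simp [hι (t + 1) ht, hι t (by omega)])
    rw [this, h.B_succ, ih (by omega), Finset.sum_range_succ, sub_sub]

lemma isDescentPath (h : Q.IsDualDescent w η aBar μ₀ xt x a μ B) (ω : Fin T → Fin n)
    {ι : ℕ → Fin T} {κ : ℕ → Fin (T + 1)} (hι : ∀ t < T, (ι t : ℕ) = t)
    (hκ : ∀ t ≤ T, (κ t : ℕ) = t) :
    Q.IsDescentPath T w η aBar (fun t => ω (ι t)) (fun t => xt ω (ι t)) (fun t => x ω (ι t))
      (fun t => a ω (ι t)) (fun t => μ ω (κ t)) := by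
  have hcast : ∀ t < T, (ι t).castSucc = κ t := fun t ht =>
    Fin.ext (by simp [hι t ht, hκ t ht.le])
  have hsucc : ∀ t < T, (ι t).succ = κ (t + 1) := fun t ht =>
    Fin.ext (by simp [hι t ht, hκ (t + 1) ht])
  refine ⟨fun t _ => h.xt_mem _ _, fun t ht hle => h.x_of_le _ _ ?_,
    fun t ht hle => h.x_of_not_le _ _ ?_, fun t ht => ?_, fun t _ => h.a_norm _ _,
    fun t _ => h.μ_mem _ _, fun t ht => ?_⟩
  · rwa [h.B_eq ω hι ht]
  · rwa [h.B_eq ω hι ht]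
  · rw [← hcast t ht]
    exact h.a_target _ _
  · rw [← hcast t ht, ← hsucc t ht]
    exact h.μ_succ _ _

open scoped Classical in
/-- `IsDescentPath.loss_le` for the algorithm on the request sequence `ω`. -/
lemma loss_le (h : Q.IsDualDescent w η aBar μ₀ xt x a μ B) (hT : 1 ≤ T)
    (hw : ∀ j, 0 < w j) (hη : 0 < η) {fBar bBar L rHi rLo : ℝ} (hS : Q.SupportBounds w fBar bBar)
    (hR : Q.RegularizerBounds w L aBar rHi rLo) (hL : 0 ≤ L) {M V : ℝ} (hLM : L ≤ M)
    (hM : ∀ j, L + (fBar + L * (bBar + aBar)) / Q.ρ j * √(w j) ≤ M)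
    (hV : V ≤ fBar + Q.r 0 + L * aBar) (ω : Fin T → Fin n) :
    ∑ t, (if ∀ s < t, Q.b (ω s) *ᵥ xt ω s ≤ B ω s.castSucc
        then Q.dualTerm (ω t) (xt ω t) (a ω t) (μ ω t.castSucc) else V) - Q.value ω (x ω) ≤
      η * T * (bBar + aBar) ^ 2 / 2 + (M ^ 2 + wNorm w μ₀ ^ 2) / η := by
  set ι : ℕ → Fin T := fun t => ⟨min t (T - 1), by omega⟩ with hιdef
  set κ : ℕ → Fin (T + 1) := fun t => ⟨min t T, by omega⟩ with hκdef
  have hι : ∀ t < T, (ι t : ℕ) = t := fun t ht => by simp [hιdef]; omega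
  have hκ : ∀ t ≤ T, (κ t : ℕ) = t := fun t ht => by simpa [hκdef] using ht
  have hιt : ∀ t : Fin T, ι t = t := fun t => Fin.ext (hι t t.2)
  have hκt : ∀ t : Fin T, κ t = t.castSucc := fun t => Fin.ext (hκ t t.2.le)
  have h1 := (h.isDescentPath ω hι hκ).loss_le hT hw hη hS hR hL hLM hM hV
  have hκ0 : κ 0 = 0 := Fin.ext (hκ 0 (Nat.zero_le T))
  rw [hκ0, h.μ_zero] at h1
  refine le_trans (le_of_eq ?_) h1
  rw [value, Finset.sum_range, Finset.sum_range, Finset.sum_range]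
  simp only [hιt, hκt]
  congr 1
  refine Finset.sum_congr rfl fun t _ => ?_
  congr 1
  refine propext ⟨fun hs s hst => ?_, fun hs s hst => ?_⟩
  · have := hs (ι s) (Fin.lt_def.2 (by rw [hι s (by omega)]; exact hst))
    rwa [h.B_eq ω hι (by omega)] at this
  · have := hs s hst
    rw [← h.B_eq ω hι s.2] at this
    simpa only [hιt] using this

end IsDualDescent

/-! ### Expectations over independent requests -/

section Expectation

variable {T : ℕ} {p : Fin n → ℝ}

lemma expect_const (hp : p ∈ stdSimplex ℝ (Fin n)) (c : ℝ) :
    expect p (fun _ : Fin T → Fin n => c) = c := by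
  rw [expect, ← Finset.sum_mul, ← Fintype.piFinset_univ, ← Finset.prod_univ_sum]
  simp [hp.2]

lemma expect_sub (V W : (Fin T → Fin n) → ℝ) :
    expect p (fun ω => V ω - W ω) = expect p V - expect p W := by
  simp only [expect, mul_sub, Finset.sum_sub_distrib]

lemma expect_sum {ι : Type*} (s : Finset ι) (V : ι → (Fin T → Fin n) → ℝ) :
    expect p (fun ω => ∑ i ∈ s, V i ω) = ∑ i ∈ s, expect p (V i) := by
  simp only [expect, Finset.mul_sum]
  exact Finset.sum_comm

lemma expect_mono (hp : p ∈ stdSimplex ℝ (Fin n)) {V W : (Fin T → Fin n) → ℝ}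
    (h : ∀ ω, V ω ≤ W ω) : expect p V ≤ expect p W :=
  Finset.sum_le_sum fun ω _ =>
    mul_le_mul_of_nonneg_left (h ω) (Finset.prod_nonneg fun t _ => hp.1 (ω t))

/-- If `g i` does not depend on the request in period `t`, then conditioning on the other requests
averages `g (ω t)` over the distribution of this request. -/
lemma expect_apply_eq (hp : p ∈ stdSimplex ℝ (Fin n)) (t : Fin T)
    (g : Fin n → (Fin T → Fin n) → ℝ)
    (hg : ∀ i ω j, g i (Function.update ω t j) = g i ω) :
    expect p (fun ω => g (ω t) ω) = expect p (fun ω => ∑ i, p i * g i ω) := by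
  -- Exchanging `ω t` with an independent copy `i` of it preserves the product weights.
  have hinv : Function.Involutive
      fun z : (Fin T → Fin n) × Fin n => (Function.update z.1 t z.2, z.1 t) := by
    rintro ⟨ω, i⟩
    simp
  have hweight : ∀ (ω : Fin T → Fin n) (i : Fin n),
      (∏ s, p (Function.update ω t i s)) * p (ω t) = (∏ s, p (ω s)) * p i := by
    intro ω i
    rw [← Finset.mul_prod_erase Finset.univ _ (Finset.mem_univ t),
      ← Finset.mul_prod_erase Finset.univ (fun s => p (ω s)) (Finset.mem_univ t),
      Finset.prod_congr rfl fun s hs => by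
        rw [Function.update_of_ne (Finset.ne_of_mem_erase hs)], Function.update_self]
    ring
  calc expect p (fun ω => g (ω t) ω)
      = ∑ z : (Fin T → Fin n) × Fin n, (∏ s, p (z.1 s)) * p z.2 * g (z.1 t) z.1 := by
        rw [Fintype.sum_prod_type, expect]
        refine Finset.sum_congr rfl fun ω _ => ?_
        dsimp only
        rw [← Finset.sum_mul, ← Finset.mul_sum, hp.2, mul_one]
    _ = ∑ z : (Fin T → Fin n) × Fin n, (∏ s, p (z.1 s)) * p z.2 * g z.2 z.1 := by
        refine Fintype.sum_equiv hinv.toPerm _ _ fun z => ?_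
        simp only [Function.Involutive.coe_toPerm, hg, hweight]
    _ = expect p (fun ω => ∑ i, p i * g i ω) := by
        rw [Fintype.sum_prod_type, expect]
        refine Finset.sum_congr rfl fun ω _ => ?_
        rw [Finset.mul_sum]
        exact Finset.sum_congr rfl fun i _ => by rw [mul_assoc]

end Expectation

/-! ### Weak duality -/

section Duality

/-- The conjugate `sup_{y ∈ X} {f i y - μᵀ b_i y}` of the reward of the request `i`. -/
noncomputable def rewardConj (Q : AllocationProblem m d n) (i : Fin n) (μ : Fin m → ℝ) : ℝ :=
  sSup ((fun y => Q.f i y - μ ⬝ᵥ (Q.b i *ᵥ y)) '' Q.X)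

/-- The conjugate `sup_{a ≤ ρ} {r a + μᵀ a}` of the regularizer as a real number; it is meaningful
on the dual domain. -/
noncomputable def regConj (Q : AllocationProblem m d n) (μ : Fin m → ℝ) : ℝ :=
  sSup ((fun a => Q.r a + μ ⬝ᵥ a) '' Set.Iic Q.ρ)

variable {Q : AllocationProblem m d n} {w : Fin m → ℝ} {fBar bBar : ℝ}

lemma le_rewardConj (hS : Q.SupportBounds w fBar bBar) (hw : ∀ j, 0 < w j) (i : Fin n)
    (μ : Fin m → ℝ) {y : Fin d → ℝ} (hy : y ∈ Q.X) :
    Q.f i y - μ ⬝ᵥ (Q.b i *ᵥ y) ≤ Q.rewardConj i μ := by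
  refine le_csSup ⟨fBar + wNorm w μ * bBar, ?_⟩ ⟨y, hy, rfl⟩
  rintro _ ⟨z, hz, rfl⟩
  have h1 := neg_wNorm_mul_le_dotProduct hw μ (Q.b i *ᵥ z)
  have h2 := mul_le_mul_of_nonneg_left (hS.b_le i z hz) (wNorm_nonneg w μ)
  have h3 := hS.f_le i z hz
  dsimp only
  linarith

lemma le_regConj {μ a : Fin m → ℝ} (hμ : μ ∈ Q.dualDomain) (ha : a ≤ Q.ρ) :
    Q.r a + μ ⬝ᵥ a ≤ Q.regConj μ := by
  obtain ⟨C, hC⟩ := mem_dualDomain_iff.1 hμ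
  refine le_csSup ⟨C, ?_⟩ ⟨a, ha, rfl⟩
  rintro _ ⟨a', ha', rfl⟩
  exact hC a' ha'

lemma dualTerm_eq {i : Fin n} {xt : Fin d → ℝ} {a μ : Fin m → ℝ} (hxt : xt ∈ Q.X)
    (hmax : IsMaxOn (fun y => Q.f i y - μ ⬝ᵥ (Q.b i *ᵥ y)) Q.X xt) (ha : Q.IsTarget μ a) :
    Q.dualTerm i xt a μ = Q.rewardConj i μ + Q.regConj μ := by
  have h1 : IsGreatest ((fun y => Q.f i y - μ ⬝ᵥ (Q.b i *ᵥ y)) '' Q.X)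
      (Q.f i xt - μ ⬝ᵥ (Q.b i *ᵥ xt)) := by
    refine ⟨⟨xt, hxt, rfl⟩, ?_⟩
    rintro _ ⟨y, hy, rfl⟩
    exact hmax hy
  have h2 : IsGreatest ((fun a => Q.r a + μ ⬝ᵥ a) '' Set.Iic Q.ρ) (Q.r a + μ ⬝ᵥ a) := by
    refine ⟨⟨a, ha.1, rfl⟩, ?_⟩
    rintro _ ⟨a', ha', rfl⟩
    exact ha.2 a' ha'
  rw [dualTerm, rewardConj, regConj, h1.csSup_eq, h2.csSup_eq]

lemma offlineValue_le {T : ℕ} {ω : Fin T → Fin n} {c : ℝ}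
    (h : ∀ y : Fin T → Fin d → ℝ, (∀ t, y t ∈ Q.X) →
      ∑ t, Q.b (ω t) *ᵥ y t ≤ (T : ℝ) • Q.ρ → Q.value ω y ≤ c) : Q.offlineValue ω ≤ c := by
  refine csSup_le ⟨_, 0, fun _ => Q.zero_mem, ?_, rfl⟩ ?_
  · simpa using smul_nonneg (Nat.cast_nonneg T) Q.rho_nonneg
  · rintro _ ⟨y, hy, hle, rfl⟩
    exact h y hy hle

/-- Weak duality: every dual variable bounds the expected offline value. -/
lemma OPT_le_dual (hS : Q.SupportBounds w fBar bBar) (hw : ∀ j, 0 < w j) {T : ℕ} (hT : 1 ≤ T)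
    {p : Fin n → ℝ} (hp : p ∈ stdSimplex ℝ (Fin n)) {μ : Fin m → ℝ} (hμ : μ ∈ Q.dualDomain) :
    Q.OPT T p ≤ T * ∑ i, p i * (Q.rewardConj i μ + Q.regConj μ) := by
  have hT' : (0 : ℝ) < T := by exact_mod_cast hT
  have h1 : ∀ ω : Fin T → Fin n, Q.offlineValue ω ≤
      ∑ t, (Q.rewardConj (ω t) μ + Q.regConj μ) := by
    refine fun ω => offlineValue_le fun y hy hle => ?_
    have h2 := le_regConj hμ (average_le_rho hT hle)
    have h3 : ∑ t, (Q.f (ω t) (y t) - μ ⬝ᵥ (Q.b (ω t) *ᵥ y t)) ≤ ∑ t, Q.rewardConj (ω t) μ :=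
      Finset.sum_le_sum fun t _ => le_rewardConj hS hw _ _ (hy t)
    rw [Finset.sum_sub_distrib, ← dotProduct_sum] at h3
    rw [value, Finset.sum_add_distrib, Finset.sum_const, Finset.card_univ, Fintype.card_fin,
      nsmul_eq_mul]
    rw [dotProduct_smul, smul_eq_mul] at h2
    have h4 := mul_le_mul_of_nonneg_left h2 hT'.le
    rw [mul_add, ← mul_assoc, mul_one_div_cancel hT'.ne', one_mul] at h4
    linarith
  refine (expect_mono hp h1).trans (le_of_eq ?_)
  rw [expect_sum]
  have h2 : ∀ t : Fin T, expect p (fun ω : Fin T → Fin n => Q.rewardConj (ω t) μ + Q.regConj μ) =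
      ∑ i, p i * (Q.rewardConj i μ + Q.regConj μ) := fun t =>
    (expect_apply_eq hp t (fun i _ => Q.rewardConj i μ + Q.regConj μ)
      fun _ _ _ => rfl).trans (expect_const hp _)
  rw [Finset.sum_congr rfl fun t _ => h2 t, Finset.sum_const, Finset.card_univ, Fintype.card_fin,
    nsmul_eq_mul]

/-- A bound on the expected offline value through the regularizer at zero consumption. -/
lemma OPT_le (hS : Q.SupportBounds w fBar bBar) (hw : ∀ j, 0 < w j) {L aBar rHi rLo : ℝ}
    (hR : Q.RegularizerBounds w L aBar rHi rLo) (hL : 0 ≤ L) {T : ℕ} (hT : 1 ≤ T)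
    {p : Fin n → ℝ} (hp : p ∈ stdSimplex ℝ (Fin n)) :
    Q.OPT T p ≤ T * (fBar + Q.r 0 + L * aBar) := by
  refine (expect_mono hp fun ω => offlineValue_le (c := T * (fBar + Q.r 0 + L * aBar))
    fun y hy hle => ?_).trans (expect_const hp _).le
  have h1 := average_le_rho hT hle
  set v := (1 / (T : ℝ)) • ∑ t, Q.b (ω t) *ᵥ y t with hv
  have h0 : 0 ≤ v :=
    smul_nonneg (by positivity) (Finset.sum_nonneg fun t _ => Q.mulVec_nonneg _ (hy t))
  have h2 := hR.r_le_add h1 Q.rho_nonneg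
  rw [sub_zero] at h2
  have h3 := mul_le_mul_of_nonneg_left
    ((wDualNorm_mono hw h0 h1).trans (hR.wDualNorm_rho_le hw hL)) hL
  have h4 : ∑ t, Q.f (ω t) (y t) ≤ T * fBar := by
    refine (Finset.sum_le_card_nsmul _ _ fBar fun t _ => hS.f_le _ _ (hy t)).trans (le_of_eq ?_)
    rw [Finset.card_univ, Fintype.card_fin, nsmul_eq_mul]
  have h5 := mul_le_mul_of_nonneg_left (h2.trans (add_le_add_right h3 _)) (Nat.cast_nonneg T)
  rw [value, ← hv]
  linarith

end Duality

/-! ### The regret bound -/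

section Regret

variable {Q : AllocationProblem m d n} {T : ℕ} {w : Fin m → ℝ} {η fBar bBar L aBar rHi rLo : ℝ}
  {μ₀ : Fin m → ℝ}
  {xt x : (Fin T → Fin n) → Fin T → Fin d → ℝ} {a : (Fin T → Fin n) → Fin T → Fin m → ℝ}
  {μ B : (Fin T → Fin n) → Fin (T + 1) → Fin m → ℝ}

open scoped Classical in
/-- The expected regret under a distribution `p`. Whether the resources are depleted before a
period is determined by earlier requests, so by weak duality the expected dual term of a period is
at least `OPT / T`. -/
lemma IsDualDescent.OPT_sub_expectedReward_le (h : Q.IsDualDescent w η aBar μ₀ xt x a μ B)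
    (hT : 1 ≤ T) (hw : ∀ j, 0 < w j) (hη : 0 < η) (hS : Q.SupportBounds w fBar bBar)
    (hR : Q.RegularizerBounds w L aBar rHi rLo) (hL : 0 ≤ L) {M : ℝ} (hLM : L ≤ M)
    (hM : ∀ j, L + (fBar + L * (bBar + aBar)) / Q.ρ j * √(w j) ≤ M)
    {p : Fin n → ℝ} (hp : p ∈ stdSimplex ℝ (Fin n)) :
    Q.OPT T p - Q.expectedReward x p ≤
      η * T * (bBar + aBar) ^ 2 / 2 + (M ^ 2 + wNorm w μ₀ ^ 2) / η := by
  have hT' : (0 : ℝ) < T := by exact_mod_cast hT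
  set V := Q.OPT T p / T with hV
  have hVle : V ≤ fBar + Q.r 0 + L * aBar := by
    rw [hV, div_le_iff₀' hT']
    exact OPT_le hS hw hR hL hT hp
  set alive : Fin T → (Fin T → Fin n) → Prop :=
    fun t ω => ∀ s < t, Q.b (ω s) *ᵥ xt ω s ≤ B ω s.castSucc with halive
  set g : Fin T → Fin n → (Fin T → Fin n) → ℝ := fun t i ω =>
    if alive t ω then Q.rewardConj i (μ ω t.castSucc) + Q.regConj (μ ω t.castSucc) else V with hg
  have hpath : ∀ ω, ∑ t, g t (ω t) ω - Q.value ω (x ω) ≤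
      η * T * (bBar + aBar) ^ 2 / 2 + (M ^ 2 + wNorm w μ₀ ^ 2) / η := by
    intro ω
    have h1 := h.loss_le hT hw hη hS hR hL hLM hM hVle ω
    simpa only [dualTerm_eq (h.xt_mem _ _) (h.xt_max _ _) (h.a_target _ _)] using h1
  have hgt : ∀ t i ω j, g t i (Function.update ω t j) = g t i ω := by
    intro t i ω j
    have hlt : ∀ s < t, Function.update ω t j s = ω s := fun s hs =>
      Function.update_of_ne hs.ne _ _
    have h1 : μ (Function.update ω t j) t.castSucc = μ ω t.castSucc :=
      (h.state_congr hw hη _ fun s hs => hlt s (Fin.castSucc_lt_castSucc_iff.1 hs)).1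
    have h2 : alive t (Function.update ω t j) ↔ alive t ω := by
      refine forall₂_congr fun s hs => ?_
      rw [hlt s hs, (h.nonanticipative s _ ω fun s' hs' => hlt s' (hs'.trans_lt hs)).1,
        (h.state_congr hw hη _ fun s' hs' =>
          hlt s' ((Fin.castSucc_lt_castSucc_iff.1 hs').trans hs)).2]
    simp only [hg, h1, h2]
  have hperiod : ∀ t, V ≤ expect p fun ω => g t (ω t) ω := by
    intro t
    rw [expect_apply_eq hp t (g t) (hgt t)]
    refine (expect_const hp V).ge.trans (expect_mono hp fun ω => ?_)
    by_cases hc : alive t ω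
    · simp only [hg, if_pos hc]
      rw [hV, div_le_iff₀' hT']
      exact OPT_le_dual hS hw hT hp (h.μ_mem _ _)
    · simp only [hg, if_neg hc]
      rw [← Finset.sum_mul, hp.2, one_mul]
  have h1 := expect_mono hp hpath
  rw [expect_const hp, expect_sub, expect_sum] at h1
  have h2 : Q.OPT T p ≤ ∑ t, expect p fun ω => g t (ω t) ω := by
    have h3 := Finset.card_nsmul_le_sum Finset.univ _ V fun t _ => hperiod t
    rw [Finset.card_univ, Fintype.card_fin, nsmul_eq_mul, hV, mul_div_cancel₀ _ hT'.ne'] at h3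
    exact h3
  have h3 : Q.expectedReward x p = expect p fun ω => Q.value ω (x ω) := rfl
  linarith

lemma le_constC₁ (i : Fin n) (hS : Q.SupportBounds w fBar bBar)
    (hR : Q.RegularizerBounds w L aBar rHi rLo) (hL : 0 ≤ L) (ha0 : 0 ≤ aBar) (j : Fin m) :
    (fBar + L * (bBar + aBar)) / Q.ρ j ≤ constC₁ Q.ρ fBar bBar L aBar rHi rLo := by
  have : Nonempty (Fin m) := ⟨j⟩
  obtain ⟨j₀, hj₀⟩ := exists_eq_ciInf_of_finite (f := Q.ρ)
  have h1 : ⨅ j, Q.ρ j ≤ Q.ρ j := ciInf_le (Set.finite_range _).bddBelow j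
  have h2 : 0 < ⨅ j, Q.ρ j := hj₀ ▸ Q.ρ_pos j₀
  have h3 := hR.bounds i 0 Q.zero_mem
  have hf := hS.fBar_nonneg
  have hb := hS.bBar_nonneg
  have hE : 0 ≤ fBar + L * (bBar + aBar) := by positivity
  rw [constC₁]
  refine div_le_div₀ ?_ ?_ h2 h1 <;> linarith

/-- The regret bound; it is vacuous when there are no requests and hence no distributions. -/
lemma IsDualDescent.regret_le (hm : 1 ≤ m) (h : Q.IsDualDescent w η aBar μ₀ xt x a μ B)
    (hT : 1 ≤ T) (hw : ∀ j, 0 < w j) (hη : 0 < η) (hS : Q.SupportBounds w fBar bBar)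
    (hR : Q.RegularizerBounds w L aBar rHi rLo) {C₁ : ℝ}
    (hC₁ : C₁ = constC₁ Q.ρ fBar bBar L aBar rHi rLo) :
    Q.regret x ≤ ((C₁ + constC₂ bBar aBar * η * T + constC₃ w μ₀ L C₁ / η : ℝ) : EReal) := by
  refine iSup₂_le fun p hp => EReal.coe_le_coe_iff.2 ?_
  have hn : Nonempty (Fin n) := by
    by_contra hn
    rw [not_nonempty_iff] at hn
    simpa using hp.2
  obtain ⟨i⟩ := hn
  have hL := hR.lipschitz_nonneg hw hm
  have ha0 : 0 ≤ aBar := (wDualNorm_nonneg _ _).trans (hR.wDualNorm_rho_le hw hL)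
  have hf := hS.fBar_nonneg
  have hb := hS.bBar_nonneg
  have hEC : ∀ j, (fBar + L * (bBar + aBar)) / Q.ρ j ≤ C₁ := fun j =>
    hC₁ ▸ le_constC₁ i hS hR hL ha0 j
  have hC0 : 0 ≤ C₁ := by
    refine le_trans ?_ (hEC ⟨0, hm⟩)
    have := Q.ρ_pos ⟨0, hm⟩
    positivity
  have hM : ∀ j, L + (fBar + L * (bBar + aBar)) / Q.ρ j * √(w j) ≤ L + C₁ * √‖w‖ := by
    intro j
    have h1 : √(w j) ≤ √‖w‖ := Real.sqrt_le_sqrt ((le_abs_self _).trans (norm_le_pi_norm w j))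
    have := mul_le_mul (hEC j) h1 (Real.sqrt_nonneg _) hC0
    linarith
  have hLM : L ≤ L + C₁ * √‖w‖ := le_add_of_nonneg_right (by positivity)
  have := h.OPT_sub_expectedReward_le hT hw hη hS hR hL hLM hM hp
  rw [constC₂, constC₃]
  linarith

end Regret

end AllocationProblem

theorem theorem1 {m d n : ℕ} (hm : 1 ≤ m) (Q : AllocationProblem m d n)
    (w : Fin m → ℝ) (hw : ∀ j, 0 < w j) (fBar bBar L aBar rHi rLo : ℝ)
    (hS : Q.SupportBounds w fBar bBar)
    (hR : Q.RegularizerBounds w L aBar rHi rLo)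
    (μ₀ : Fin m → ℝ) (hμ₀ : μ₀ ∈ Q.dualDomain)
    (C₁ C₂ C₃ : ℝ)
    (hC₁ : C₁ = constC₁ Q.ρ fBar bBar L aBar rHi rLo)
    (hC₂ : C₂ = constC₂ bBar aBar)
    (hC₃ : C₃ = constC₃ w μ₀ L C₁) :
    (∀ (T : ℕ), 1 ≤ T → ∀ (η : ℝ), 0 < η →
      ∀ (xt x : (Fin T → Fin n) → Fin T → Fin d → ℝ)
        (a : (Fin T → Fin n) → Fin T → Fin m → ℝ)
        (μ B : (Fin T → Fin n) → Fin (T + 1) → Fin m → ℝ),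
        Q.IsDualDescent w η aBar μ₀ xt x a μ B →
        Q.regret x ≤ ((C₁ + C₂ * η * T + C₃ / η : ℝ) : EReal)) ∧
    (∀ c c' : ℝ, 0 < c → ∃ K : ℝ, ∀ (T : ℕ), 1 ≤ T → ∀ (η : ℝ),
      c / √(T : ℝ) ≤ η → η ≤ c' / √(T : ℝ) →
      ∀ (xt x : (Fin T → Fin n) → Fin T → Fin d → ℝ)
        (a : (Fin T → Fin n) → Fin T → Fin m → ℝ)
        (μ B : (Fin T → Fin n) → Fin (T + 1) → Fin m → ℝ),
        Q.IsDualDescent w η aBar μ₀ xt x a μ B →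
        Q.regret x ≤ ((K * √(T : ℝ) : ℝ) : EReal)) := by
  have hreg : ∀ (T : ℕ), 1 ≤ T → ∀ (η : ℝ), 0 < η →
      ∀ (xt x : (Fin T → Fin n) → Fin T → Fin d → ℝ)
        (a : (Fin T → Fin n) → Fin T → Fin m → ℝ)
        (μ B : (Fin T → Fin n) → Fin (T + 1) → Fin m → ℝ),
        Q.IsDualDescent w η aBar μ₀ xt x a μ B →
        Q.regret x ≤ ((C₁ + C₂ * η * T + C₃ / η : ℝ) : EReal) := by
    intro T hT η hη xt x a μ B h
    rw [hC₂, hC₃]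
    exact h.regret_le hm hT hw hη hS hR hC₁
  refine ⟨hreg, fun c c' hc => ⟨|C₁| + C₂ * c' + C₃ / c, ?_⟩⟩
  intro T hT η hη hη' xt x a μ B h
  have hT1 : (1 : ℝ) ≤ T := by exact_mod_cast hT
  have hs1 : 1 ≤ √(T : ℝ) := Real.one_le_sqrt.2 hT1
  have hs0 : 0 < √(T : ℝ) := by linarith
  have hη0 : 0 < η := (div_pos hc hs0).trans_le hη
  refine (hreg T hT η hη0 xt x a μ B h).trans (EReal.coe_le_coe_iff.2 ?_)
  have hC₂0 : 0 ≤ C₂ := by rw [hC₂, constC₂]; positivity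
  have hC₃0 : 0 ≤ C₃ := by rw [hC₃, constC₃]; positivity
  have h1 : C₁ ≤ |C₁| * √(T : ℝ) :=
    (le_abs_self _).trans (le_mul_of_one_le_right (abs_nonneg _) hs1)
  have h2 : C₂ * η * T ≤ C₂ * c' * √(T : ℝ) := by
    rw [le_div_iff₀ hs0] at hη'
    calc C₂ * η * T = C₂ * (η * √(T : ℝ)) * √(T : ℝ) := by
          rw [mul_assoc, mul_assoc, mul_assoc, Real.mul_self_sqrt (by positivity)]
      _ ≤ C₂ * c' * √(T : ℝ) := by gcongr
  have h3 : C₃ / η ≤ C₃ / c * √(T : ℝ) := by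
    rw [div_le_iff₀ hs0] at hη
    rw [div_mul_eq_mul_div, div_le_div_iff₀ hη0 hc, mul_assoc]
    refine mul_le_mul_of_nonneg_left ?_ hC₃0
    linarith
  linarith
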